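/- **Theorem (Mean circular law).** Let $(G_{ij})_{i,j\ge 1}$ be i.i.d. complex random variables on a probability space, each with the Gaussian law $\mathcal N(0,\tfrac12 I_2)$ on $\mathbb C=\mathbb R^2$, i.e. with Lebesgue density $z\mapsto \pi^{-1}e^{-|z|^2}$, and for $n\ge 1$ let $G=(G_{ij})_{1\le i,j\le n}$ (the complex Ginibre ensemble). For an $n\times n$ complex matrix $A$ with eigenvalues $\lambda_1(A),\dots,\lambda_n(A)$ (the roots of its characteristic polynomial, counted with multiplicity) let $\mu_A=\frac1n\sum_{k=1}^n\delta_{\lambda_k(A)}$, and for a random probability measure $\mu$ on $\mathbb C$ let $\mathbb E\mu$ be the probability measure with $\int f\,d\mathbb E\mu=\mathbb E\int f\,d\mu$ for all bounded measurable $f$. Then $\mu_{n^{-1/2}G}$ is a random probability measure, and $\mathbb E\mu_{n^{-1/2}G}$ converges weakly, as $n\to\infty$, to the uniform law $\mathcal C_1$ on the unit disc, with density $z\mapsto\pi^{-1}\mathbf 1_{\{|z|\le 1\}}$: for every bounded continuous $f:\mathbb C\to\mathbb R$, $$\lim_{n\to\infty}\int f\,d\,\mathbb E\mu_{n^{-1/2}G}=\frac1\pi\int_{|z|\le1}f(z)\,dz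 .$$ -/

import Mathlib

open MeasureTheory ProbabilityTheory Filter Topology
open scoped ENNReal BoundedContinuousFunction

noncomputable section

/-- The Gaussian law `N(0, I₂/2)` on `ℂ = ℝ²`, of Lebesgue density `z ↦ π⁻¹ exp (-|z|²)`. -/
def complexGaussian : Measure ℂ :=
  volume.withDensity fun z => ENNReal.ofReal (Real.pi⁻¹ * Real.exp (-‖z‖ ^ 2))

/-- The circular law: the uniform law on the closed unit disc of `ℂ`, of Lebesgue density
`z ↦ π⁻¹ 1_{|z| ≤ 1}`. -/
def circularLaw : Measure ℂ :=
  volume.withDensity ({z : ℂ | ‖z‖ ≤ 1}.indicator fun _ => ENNReal.ofReal Real.pi⁻¹)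

/-- The empirical eigenvalue measure `n⁻¹ ∑ₖ δ_{λₖ(A)}` of an `n × n` complex matrix `A`, the
eigenvalues being the roots of the characteristic polynomial, counted with multiplicity. -/
def empiricalEigenvalueMeasure {n : ℕ} (A : Matrix (Fin n) (Fin n) ℂ) : Measure ℂ :=
  (n : ℝ≥0∞)⁻¹ • (A.charpoly.roots.map Measure.dirac).sum

/-- The `n × n` upper left corner of an infinite table of random variables, scaled by
`n^{-1/2}`. -/
def scaledCorner {Ω : Type*} (G : ℕ → ℕ → Ω → ℂ) (n : ℕ) (ω : Ω) :
    Matrix (Fin n) (Fin n) ℂ :=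
  (Real.sqrt n)⁻¹ • Matrix.of fun i j : Fin n => G i j ω

/-- The mean `E μ` of a random measure `μ` on `ℂ`, characterised by `∫ f d(E μ) = E ∫ f dμ`
(meaningful when `ω ↦ μ ω` is a.e. measurable). -/
def meanMeasure {Ω : Type*} [MeasurableSpace Ω] (P : Measure Ω) (μ : Ω → Measure ℂ) :
    Measure ℂ :=
  P.bind μ

/-- An infinite table of i.i.d. complex Gaussian variables of law `N(0, I₂/2)`, whose `n × n`
corners form the complex Ginibre ensemble. -/
structure IsComplexGinibre {Ω : Type*} [MeasurableSpace Ω] (P : Measure Ω)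
    (G : ℕ → ℕ → Ω → ℂ) : Prop where
  hasLaw : ∀ i j, HasLaw (G i j) complexGaussian P
  indep : iIndepFun (fun p : ℕ × ℕ => G p.1 p.2) P

end

/-! ### Area formula with multiplicity, as an inequality -/

section AreaFormula

/-! The mean eigenvalue density of the Ginibre matrix is `π⁻¹ exp (-|z|²) ∑_{k<n} |z|^(2k) / k!`,
and after rescaling by `√n` it tends to `π⁻¹` inside the unit disc. Only the lower bound on the
density is needed: the mean measures and the limit all have mass one, so by the portmanteau theorem
it suffices that `circularLaw V` is at most the liminf of the masses of `V` for every open `V`. No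
mass can be lost, so neither almost sure simplicity of the spectrum nor an estimate outside the disc
is required.

For the lower bound, write the matrix as a first column `c` and remaining columns `U`. If `(1, y)`
is an eigenvector with eigenvalue `l`, then `c = l (1, y) - U y`. For fixed `U` this is a
holomorphic map `(l, y) ↦ c` between spaces of equal dimension, and regular points of one fibre have
distinct `l`. The area formula therefore bounds an integral over `(l, y)` by the integrated
eigenvalue count (`lintegral_eigenChart_le`).

Next `U` is integrated out at fixed `(l, y)` (`lintegral_det_mul_gaussianDensity`). Completing the
square row by row turns the Gaussian weight into `exp (-|l|²)` times a standard one, with Jacobian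
`(1 + |y|²)^-(m+1)`. The Jacobian of the chart becomes `|det (l - O Z)|²` with `O` a coisometry,
whose mean is `m! ∑_{k≤m} |l|^(2k) / k!` (`lintegral_norm_det_sub_sq`). The remaining integral over
`y` is `π^m / m!` (`lintegral_affineNormSq_pow_inv`), and Fatou's lemma concludes. -/

theorem sum_lintegral_le_lintegral_sum {α ι : Type*} [MeasurableSpace α] (μ : Measure α)
    (g : ι → α → ℝ≥0∞) (s : Finset ι) :
    ∑ i ∈ s, ∫⁻ x, g i x ∂μ ≤ ∫⁻ x, ∑ i ∈ s, g i x ∂μ := by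
  classical
  induction s using Finset.induction_on with
  | empty => simp
  | insert a s ha ih =>
    simp_rw [Finset.sum_insert ha]
    exact (add_le_add_right ih _).trans (le_lintegral_add _ _)

/-- One half of the area formula with multiplicity: if `H c` dominates every finite sum of `h` over
regular preimages of `c`, then `∫ |det f'| h ≤ ∫ H`. -/
theorem lintegral_abs_det_fderiv_mul_le_of_forall_fiber {E : Type*} [NormedAddCommGroup E]
    [NormedSpace ℝ E] [FiniteDimensional ℝ E] [MeasurableSpace E] [BorelSpace E]
    (μ : Measure E) [μ.IsAddHaarMeasure] {f : E → E} {f' : E → E →L[ℝ] E}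
    (hf : ∀ x, HasFDerivAt f (f' x) x) (hf' : Measurable f')
    {h H : E → ℝ≥0∞}
    (hH : ∀ (c : E) (t : Finset E), (∀ x ∈ t, f x = c ∧ (f' x).det ≠ 0) → ∑ x ∈ t, h x ≤ H c) :
    ∫⁻ x, ENNReal.ofReal |(f' x).det| * h x ∂μ ≤ ∫⁻ c, H c ∂μ := by
  classical
  have hdet : Measurable fun x => (f' x).det :=
    ContinuousLinearMap.continuous_det.measurable.comp hf'
  set s : Set E := {x | (f' x).det ≠ 0} with hs_def
  have hs : MeasurableSet s := (hdet (measurableSet_singleton 0)).compl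
  -- A map within `‖A⁻¹‖⁻¹ / 2` of an invertible `A` is injective. For singular `A`, or when the
  -- space is trivial, the radius `1` is a dummy value.
  have hr : ∀ A : E →L[ℝ] E, ∃ r : NNReal, r ≠ 0 ∧ (A.det ≠ 0 → ∀ u : Set E,
      ApproximatesLinearOn f A u r → Set.InjOn f u) := by
    intro A
    by_cases hA : A.det = 0
    · exact ⟨1, one_ne_zero, fun h => absurd hA h⟩
    · let B := A.toContinuousLinearEquivOfDetNeZero hA
      rcases B.subsingleton_or_nnnorm_symm_pos with hsub | hpos
      · exact ⟨1, one_ne_zero, fun _ u _ x _ y _ _ => hsub.elim x y⟩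
      · refine ⟨‖(B.symm : E →L[ℝ] E)‖₊⁻¹ / 2, (half_pos (inv_pos.2 hpos)).ne', fun _ u hu => ?_⟩
        have hu' : ApproximatesLinearOn f (B : E →L[ℝ] E) u (‖(B.symm : E →L[ℝ] E)‖₊⁻¹ / 2) := by
          simpa [B] using hu
        exact hu'.injOn (Or.inr (half_lt_self (inv_pos.2 hpos)))
  choose r hr0 hr using hr
  obtain ⟨t, A, htd, htm, htc, hta, htA⟩ :=
    exists_partition_approximatesLinearOn_of_hasFDerivWithinAt f s f'
      (fun x _ => (hf x).hasFDerivWithinAt) r hr0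
  have hinj : ∀ k, Set.InjOn f (s ∩ t k) := by
    intro k
    rcases s.eq_empty_or_nonempty with hse | hne
    · simp [hse]
    · obtain ⟨y, hy, hAy⟩ := htA hne k
      exact hr (A k) (hAy ▸ hy) _ (hta k)
  have hmeas : ∀ k, MeasurableSet (s ∩ t k) := fun k => hs.inter (htm k)
  have hcover : s = ⋃ k, s ∩ t k := by
    rw [← Set.inter_iUnion]; exact (Set.inter_eq_left.2 htc).symm
  have hdisj : Pairwise (Function.onFun Disjoint fun k => s ∩ t k) := fun i j hij =>
    (htd hij).mono Set.inter_subset_right Set.inter_subset_right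
  -- `g k` is `h` transported along the inverse branch of `f` on the `k`-th injectivity piece.
  let g : ℕ → E → ℝ≥0∞ := fun k => (f '' (s ∩ t k)).indicator
    fun c => h (Function.invFunOn f (s ∩ t k) c)
  have hpiece : ∀ k, ∫⁻ x in s ∩ t k, ENNReal.ofReal |(f' x).det| * h x ∂μ = ∫⁻ c, g k c ∂μ := by
    intro k
    have himg : MeasurableSet (f '' (s ∩ t k)) :=
      measurable_image_of_fderivWithin (hmeas k) (fun x _ => (hf x).hasFDerivWithinAt) (hinj k)
    rw [lintegral_indicator himg, lintegral_image_eq_lintegral_abs_det_fderiv_mul μ (hmeas k)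
      (fun x _ => (hf x).hasFDerivWithinAt) (hinj k)]
    refine setLIntegral_congr_fun (hmeas k) fun x hx => ?_
    simp only [(hinj k).leftInvOn_invFunOn hx]
  -- The pieces are disjoint, so different branches give different regular preimages of `c`, and the
  -- sum runs over a finite part of the fibre.
  have hsum : ∀ (c : E) (K : Finset ℕ), ∑ k ∈ K, g k c ≤ H c := by
    intro c K
    let K' := K.filter fun k => c ∈ f '' (s ∩ t k)
    let φ : ℕ → E := fun k => Function.invFunOn f (s ∩ t k) c
    have hφ : ∀ k ∈ K', φ k ∈ s ∩ t k ∧ f (φ k) = c := fun k hk =>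
      ⟨Function.invFunOn_mem (Finset.mem_filter.1 hk).2,
        Function.invFunOn_eq (Finset.mem_filter.1 hk).2⟩
    have hφinj : Set.InjOn φ K' := by
      intro i hi j hj hij
      by_contra hne
      have h1 := (hφ i hi).1
      rw [hij] at h1
      exact Set.disjoint_left.1 (hdisj hne) h1 (hφ j hj).1
    calc ∑ k ∈ K, g k c = ∑ k ∈ K', h (φ k) := by
          rw [Finset.sum_filter]
          exact Finset.sum_congr rfl fun k _ => by simp only [g, Set.indicator_apply]; rfl
      _ = ∑ x ∈ K'.image φ, h x := (Finset.sum_image hφinj).symm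
      _ ≤ H c := hH c _ fun x hx => by
          obtain ⟨k, hk, rfl⟩ := Finset.mem_image.1 hx
          exact ⟨(hφ k hk).2, (hφ k hk).1.1⟩
  calc ∫⁻ x, ENNReal.ofReal |(f' x).det| * h x ∂μ
      = ∫⁻ x in s, ENNReal.ofReal |(f' x).det| * h x ∂μ := by
        rw [← lintegral_indicator hs]
        congr 1 with x
        by_cases hx : x ∈ s
        · simp [hx]
        · have : (f' x).det = 0 := not_not.1 hx
          simp [hx, this]
    _ = ∑' k, ∫⁻ x in s ∩ t k, ENNReal.ofReal |(f' x).det| * h x ∂μ := by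
        conv_lhs => rw [hcover]
        exact lintegral_iUnion hmeas hdisj _
    _ = ∑' k, ∫⁻ c, g k c ∂μ := tsum_congr hpiece
    _ ≤ ∫⁻ c, H c ∂μ := by
        -- Passing to finite sums leaves only superadditivity of the lower integral, which needs no
        -- measurability of `h` or `H`.
        rw [ENNReal.tsum_eq_iSup_sum]
        exact iSup_le fun K => (sum_lintegral_le_lintegral_sum μ g K).trans
          (lintegral_mono fun c => hsum c K)

end AreaFormula

/-! ### Integrals and densities for product measures -/

section ProductMeasures

theorem lintegral_fin_prod_eq_prod {n : ℕ} {E : Type*} [MeasurableSpace E]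
    {μ : Fin n → Measure E} [∀ i, SigmaFinite (μ i)] {f : Fin n → E → ℝ≥0∞}
    (hf : ∀ i, Measurable (f i)) :
    ∫⁻ x : Fin n → E, ∏ i, f i (x i) ∂(Measure.pi μ) = ∏ i, ∫⁻ x, f i x ∂(μ i) := by
  induction n with
  | zero => simp
  | succ n ih =>
    rw [← ((measurePreserving_piFinSuccAbove μ 0).symm).lintegral_comp_emb
      (MeasurableEquiv.measurableEmbedding _)]
    simp_rw [MeasurableEquiv.piFinSuccAbove_symm_apply, Fin.insertNthEquiv, Fin.prod_univ_succ,
      Fin.insertNth_zero]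
    simp only [Fin.zero_succAbove, Equiv.coe_fn_mk, Fin.cons_zero, Fin.cons_succ]
    rw [← ih fun i => hf i.succ]
    exact lintegral_prod_mul (hf 0).aemeasurable
      (Finset.measurable_prod _ fun i _ => (hf _).comp (measurable_pi_apply i)).aemeasurable

theorem lintegral_fintype_prod_eq_prod {ι E : Type*} [Fintype ι] [MeasurableSpace E]
    {μ : ι → Measure E} [∀ i, SigmaFinite (μ i)] {f : ι → E → ℝ≥0∞}
    (hf : ∀ i, Measurable (f i)) :
    ∫⁻ x : ι → E, ∏ i, f i (x i) ∂(Measure.pi μ) = ∏ i, ∫⁻ x, f i x ∂(μ i) := by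
  let e := (Fintype.equivFin ι).symm
  rw [← (measurePreserving_piCongrLeft _ e).lintegral_comp_emb
    (MeasurableEquiv.measurableEmbedding _)]
  simp_rw [← e.prod_comp, MeasurableEquiv.coe_piCongrLeft, Equiv.piCongrLeft_apply_apply]
  exact lintegral_fin_prod_eq_prod fun i => hf _

theorem pi_withDensity {ι E : Type*} [Fintype ι] [MeasurableSpace E] (μ : Measure E)
    [SigmaFinite μ] {g : E → ℝ≥0∞} (hg : Measurable g) [SigmaFinite (μ.withDensity g)] :
    Measure.pi (fun _ : ι => μ.withDensity g) =
      (Measure.pi fun _ : ι => μ).withDensity fun x => ∏ i, g (x i) := by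
  refine Measure.pi_eq fun s hs => ?_
  rw [withDensity_apply _ (MeasurableSet.univ_pi hs),
    ← lintegral_indicator (MeasurableSet.univ_pi hs)]
  have : ∀ x : ι → E, (Set.univ.pi s).indicator (fun x => ∏ i, g (x i)) x =
      ∏ i, (s i).indicator g (x i) := by
    intro x
    by_cases hx : x ∈ Set.univ.pi s
    · rw [Set.indicator_of_mem hx]
      exact Finset.prod_congr rfl fun i _ => by
        rw [Set.indicator_of_mem (hx i (Set.mem_univ i))]
    · rw [Set.indicator_of_notMem hx]
      simp only [Set.mem_pi, Set.mem_univ, true_implies, not_forall] at hx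
      obtain ⟨i, hi⟩ := hx
      exact (Finset.prod_eq_zero (Finset.mem_univ i) (Set.indicator_of_notMem hi _)).symm
  simp_rw [this]
  rw [lintegral_fintype_prod_eq_prod fun i => hg.indicator (hs i)]
  exact Finset.prod_congr rfl fun i _ => by
    rw [lintegral_indicator (hs i), withDensity_apply _ (hs i)]

/-- Regrouping the coordinates of a product measure by the second index. -/
theorem measurePreserving_curry_swap {ι κ E : Type*} [Fintype ι] [Fintype κ] [MeasurableSpace E]
    (μ : Measure E) [SigmaFinite μ] :
    MeasurePreserving (fun (z : κ → ι → E) (p : ι × κ) => z p.2 p.1)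
      (Measure.pi fun _ => Measure.pi fun _ => μ) (Measure.pi fun _ => μ) where
  measurable := by fun_prop
  map_eq := by
    symm
    refine Measure.pi_eq fun s hs => ?_
    rw [Measure.map_apply (by fun_prop) (MeasurableSet.univ_pi hs)]
    have : (fun (z : κ → ι → E) (p : ι × κ) => z p.2 p.1) ⁻¹' (Set.univ.pi s) =
        Set.univ.pi fun j => Set.univ.pi fun i => s (i, j) := by
      ext z
      simp only [Set.mem_preimage, Set.mem_pi, Set.mem_univ, true_implies, Prod.forall]
      exact forall_comm
    rw [this]
    simp only [Measure.pi_pi]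
    rw [Fintype.prod_prod_type_right]

end ProductMeasures

/-! ### Measurability of the empirical eigenvalue measure -/

section Measurability

theorem IsSigmaCompact.measurableSet {X : Type*} [TopologicalSpace X] [T2Space X]
    [MeasurableSpace X] [OpensMeasurableSpace X] {s : Set X} (hs : IsSigmaCompact s) :
    MeasurableSet s := by
  obtain ⟨K, hK, rfl⟩ := hs
  exact MeasurableSet.iUnion fun i => (hK i).measurableSet

theorem measurable_charpoly_eval {α : Type*} [MeasurableSpace α] {n : ℕ}
    {A : α → Matrix (Fin n) (Fin n) ℂ} (hA : ∀ i j, Measurable fun a => A a i j) (z : ℂ) :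
    Measurable fun a => (A a).charpoly.eval z := by
  simp_rw [Matrix.eval_charpoly, Matrix.det_apply', Matrix.sub_apply]
  refine Finset.measurable_sum _ fun σ _ => Measurable.const_mul ?_ _
  exact Finset.measurable_prod _ fun i _ => (hA _ _).const_sub _

theorem card_roots_charpoly {n : ℕ} (A : Matrix (Fin n) (Fin n) ℂ) :
    A.charpoly.roots.card = n := by
  rw [IsAlgClosed.card_roots_eq_natDegree, Matrix.charpoly_natDegree_eq_dim, Fintype.card_fin]

theorem exists_eigenvalue_enumeration {n : ℕ} (A : Matrix (Fin n) (Fin n) ℂ) :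
    ∃ l : Fin n → ℂ, A.charpoly.roots = Finset.univ.val.map l := by
  have hlen : A.charpoly.roots.toList.length = n := by
    rw [Multiset.length_toList, card_roots_charpoly]
  refine ⟨fun i => A.charpoly.roots.toList.get (i.cast hlen.symm), ?_⟩
  conv_lhs => rw [← Multiset.coe_toList A.charpoly.roots]
  rw [Fin.univ_val_map, Multiset.coe_eq_coe]
  refine List.Perm.of_eq (List.ext_getElem (by simp [hlen]) fun i h1 h2 => by simp)

/-- Two polynomials of degree `n` that agree at the `n + 1` points `0, …, n` coincide. The spectrum
is thus encoded by finitely many measurable functions of the entries. -/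
theorem charpoly_eq_of_eval_eq {n : ℕ} {A : Matrix (Fin n) (Fin n) ℂ} {l : Fin n → ℂ}
    (h : ∀ k : Fin (n + 1), A.charpoly.eval (k : ℂ) = ∏ i, ((k : ℂ) - l i)) :
    A.charpoly.roots = Finset.univ.val.map l := by
  have hp : A.charpoly = ∏ i, (Polynomial.X - Polynomial.C (l i)) := by
    refine Polynomial.eq_of_degrees_lt_of_eval_index_eq (Finset.univ : Finset (Fin (n + 1)))
      (v := fun k : Fin (n + 1) => ((k : ℕ) : ℂ)) ?_ ?_ ?_ ?_
    · intro i _ j _ hij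
      exact Fin.ext (Nat.cast_injective (R := ℂ) hij)
    · rw [Matrix.charpoly_degree_eq_dim]
      simp only [Fintype.card_fin, Finset.card_univ]
      exact_mod_cast Nat.lt_succ_self n
    · rw [Polynomial.degree_prod]
      simp only [Polynomial.degree_X_sub_C, Finset.sum_const, Finset.card_univ, Fintype.card_fin,
        nsmul_eq_mul, mul_one]
      exact_mod_cast Nat.lt_succ_self n
    · intro k _
      rw [h k, Polynomial.eval_prod]
      simp
  rw [hp]
  exact Polynomial.roots_multiset_prod_X_sub_C (Finset.univ.val.map l) ▸ by
    rw [Multiset.map_map]; rfl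

theorem empiricalEigenvalueMeasure_apply {n : ℕ} {A : Matrix (Fin n) (Fin n) ℂ} {l : Fin n → ℂ}
    (hl : A.charpoly.roots = Finset.univ.val.map l) (s : Set ℂ) :
    empiricalEigenvalueMeasure A s = (n : ℝ≥0∞)⁻¹ * ∑ i, Measure.dirac (l i) s := by
  rw [empiricalEigenvalueMeasure, hl, Multiset.map_map, Measure.smul_apply, smul_eq_mul]
  congr 1
  change (∑ i, Measure.dirac (l i)) s = _
  rw [Measure.finsetSum_apply]

theorem isProbabilityMeasure_empiricalEigenvalueMeasure {n : ℕ} (hn : 1 ≤ n)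
    (A : Matrix (Fin n) (Fin n) ℂ) : IsProbabilityMeasure (empiricalEigenvalueMeasure A) := by
  obtain ⟨l, hl⟩ := exists_eigenvalue_enumeration A
  refine ⟨?_⟩
  rw [empiricalEigenvalueMeasure_apply hl]
  simp only [measure_univ, Finset.sum_const, Finset.card_univ, Fintype.card_fin, nsmul_eq_mul,
    mul_one]
  exact ENNReal.inv_mul_cancel (by exact_mod_cast (by omega : n ≠ 0)) (ENNReal.natCast_ne_top n)

/-- No measurable ordering of the eigenvalues is needed. Closed sets form a generating π-system, and
having at least `k` eigenvalues in a closed set is a Borel condition on the values of the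
characteristic polynomial. -/
theorem measurable_empiricalEigenvalueMeasure {α : Type*} [MeasurableSpace α] {n : ℕ}
    (hn : 1 ≤ n) {A : α → Matrix (Fin n) (Fin n) ℂ} (hA : ∀ i j, Measurable fun a => A a i j) :
    Measurable fun a => empiricalEigenvalueMeasure (A a) := by
  classical
  have hprob := fun a => isProbabilityMeasure_empiricalEigenvalueMeasure hn (A a)
  refine Measurable.measure_of_isPiSystem_of_isProbabilityMeasure
    (S := {s : Set ℂ | IsClosed s}) ?_ isPiSystem_isClosed fun s hs => ?_
  · rw [← borel_eq_generateFrom_isClosed]; exact BorelSpace.measurable_eq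
  replace hs : IsClosed s := hs
  let e : (Fin n → ℂ) → Fin (n + 1) → ℂ := fun l k => ∏ i, ((k : ℂ) - l i)
  have he : Continuous e := by fun_prop
  let N : (Fin n → ℂ) → ℕ := fun l => (Finset.univ.filter fun i => l i ∈ s).card
  have hsum : ∀ l : Fin n → ℂ, ∑ i, Measure.dirac (l i) s = (N l : ℝ≥0∞) := by
    intro l
    simp only [Measure.dirac_apply' _ hs.measurableSet, N, Set.indicator_apply, Pi.one_apply]
    rw [Finset.sum_boole]
  choose l hl using fun a => exists_eigenvalue_enumeration (A a)
  have hle : ∀ a, (fun k : Fin (n + 1) => (A a).charpoly.eval (k : ℂ)) = e (l a) := by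
    intro a
    ext k
    have hsp := (IsAlgClosed.splits (A a).charpoly).eq_prod_roots_of_monic
      (Matrix.charpoly_monic _)
    conv_lhs => rw [hsp, hl a, Multiset.map_map, Polynomial.eval_multiset_prod, Multiset.map_map]
    simp [e, Finset.prod]
  have hNl : Measurable fun a => N (l a) := by
    refine measurable_of_Ici fun k => ?_
    have hclosed : IsClosed {x : Fin n → ℂ | k ≤ N x} := by
      have : {x : Fin n → ℂ | k ≤ N x} =
          ⋃ J ∈ (Finset.univ.filter fun J : Finset (Fin n) => k ≤ J.card),
            ⋂ i ∈ J, {x : Fin n → ℂ | x i ∈ s} := by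
        ext x
        simp only [Set.mem_ofPred_eq, Set.mem_iUnion, Set.mem_iInter, Finset.mem_filter,
          Finset.mem_univ, true_and, exists_prop]
        refine ⟨fun h => ⟨_, h, fun i hi => (Finset.mem_filter.1 hi).2⟩, ?_⟩
        rintro ⟨J, hJ, hx⟩
        exact hJ.trans (Finset.card_le_card fun i hi => by simpa using hx i hi)
      rw [this]
      exact isClosed_biUnion_finset fun J _ => isClosed_biInter fun i _ =>
        hs.preimage (continuous_apply i)
    -- A closed subset of `ℂⁿ` is σ-compact, hence so is its continuous image, which is therefore
    -- Borel.
    have himg : MeasurableSet (e '' {x : Fin n → ℂ | k ≤ N x}) :=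
      ((isSigmaCompact_univ.of_isClosed_subset hclosed (Set.subset_univ _)).image he).measurableSet
    -- Two enumerations with the same image under `e` have the same multiset of values, and `N`
    -- depends only on that multiset.
    have heq : (fun a => N (l a)) ⁻¹' Set.Ici k =
        (fun a (k : Fin (n + 1)) => (A a).charpoly.eval (k : ℂ)) ⁻¹'
          (e '' {x : Fin n → ℂ | k ≤ N x}) := by
      ext a
      simp only [Set.mem_preimage, Set.mem_Ici, Set.mem_image, Set.mem_ofPred_eq]
      refine ⟨fun h => ⟨l a, h, (hle a).symm⟩, ?_⟩
      rintro ⟨x, hx, hxa⟩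
      have hx' := charpoly_eq_of_eval_eq fun k => (congrFun hxa k).symm
      have hcard : ∀ y : Fin n → ℂ, N y = (Finset.univ.val.map y).countP (· ∈ s) := by
        intro y
        rw [Multiset.countP_map]; rfl
      rwa [hcard, ← hl a, hx', ← hcard]
    rw [heq]
    exact measurable_pi_lambda _ (fun k => measurable_charpoly_eval hA _) himg
  have : (fun a => empiricalEigenvalueMeasure (A a) s) =
      fun a => (n : ℝ≥0∞)⁻¹ * (N (l a) : ℝ≥0∞) := by
    ext a
    rw [empiricalEigenvalueMeasure_apply (hl a), hsum]
  rw [this]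
  exact ((measurable_from_top (f := fun k : ℕ => (k : ℝ≥0∞))).comp hNl).const_mul _

end Measurability

/-! ### The complex Gaussian law and its first two moments -/

section Gaussian

theorem measurable_complexGaussian_density :
    Measurable fun z : ℂ => ENNReal.ofReal (Real.pi⁻¹ * Real.exp (-‖z‖ ^ 2)) := by
  fun_prop

theorem integral_exp_neg_norm_sq : ∫ z : ℂ, Real.exp (-‖z‖ ^ 2) = Real.pi := by
  have h := Complex.integral_rpow_mul_exp_neg_rpow (p := 2) (q := 0) (by norm_num) (by norm_num)
  norm_num at h
  exact h

theorem integral_norm_sq_mul_exp_neg_norm_sq :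
    ∫ z : ℂ, ‖z‖ ^ 2 * Real.exp (-‖z‖ ^ 2) = Real.pi := by
  have h := Complex.integral_rpow_mul_exp_neg_rpow (p := 2) (q := 2) (by norm_num) (by norm_num)
  norm_num at h
  exact h

instance isProbabilityMeasure_complexGaussian : IsProbabilityMeasure complexGaussian := by
  refine ⟨?_⟩
  rw [complexGaussian, withDensity_apply _ MeasurableSet.univ, Measure.restrict_univ,
    ← ofReal_integral_eq_lintegral_ofReal, integral_const_mul, integral_exp_neg_norm_sq,
    inv_mul_cancel₀ Real.pi_ne_zero, ENNReal.ofReal_one]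
  · refine Integrable.const_mul (Integrable.of_integral_ne_zero ?_) _
    rw [integral_exp_neg_norm_sq]; exact Real.pi_ne_zero
  · exact Eventually.of_forall fun z => by positivity

theorem integral_complexGaussian {F : Type*} [NormedAddCommGroup F] [NormedSpace ℝ F] (f : ℂ → F) :
    ∫ z, f z ∂complexGaussian = ∫ z, (Real.pi⁻¹ * Real.exp (-‖z‖ ^ 2)) • f z := by
  rw [complexGaussian, integral_withDensity_eq_integral_toReal_smul
    measurable_complexGaussian_density (Eventually.of_forall fun _ => ENNReal.ofReal_lt_top)]
  exact integral_congr_ae (Eventually.of_forall fun z => by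
    dsimp only
    rw [ENNReal.toReal_ofReal (by positivity)])

theorem integral_id_complexGaussian : ∫ z, z ∂complexGaussian = 0 := by
  rw [integral_complexGaussian]
  have h := integral_neg_eq_self (fun z : ℂ => (Real.pi⁻¹ * Real.exp (-‖z‖ ^ 2)) • z) volume
  simp only [norm_neg, smul_neg] at h
  rw [integral_neg] at h
  exact self_eq_neg.1 h.symm

theorem integral_norm_sq_complexGaussian : ∫ z, ‖z‖ ^ 2 ∂complexGaussian = 1 := by
  rw [integral_complexGaussian]
  have : ∀ z : ℂ, (Real.pi⁻¹ * Real.exp (-‖z‖ ^ 2)) • ‖z‖ ^ 2 =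
      Real.pi⁻¹ * (‖z‖ ^ 2 * Real.exp (-‖z‖ ^ 2)) := fun z => by rw [smul_eq_mul]; ring
  simp_rw [this]
  rw [integral_const_mul, integral_norm_sq_mul_exp_neg_norm_sq, inv_mul_cancel₀ Real.pi_ne_zero]

theorem memLp_id_complexGaussian : MemLp (fun z : ℂ => z) 2 complexGaussian := by
  rw [memLp_two_iff_integrable_sq_norm (by fun_prop)]
  refine Integrable.of_integral_ne_zero ?_
  rw [integral_norm_sq_complexGaussian]; exact one_ne_zero

/-- The standard Gaussian law on `ℂ^ι`. -/
noncomputable def piComplexGaussian (ι : Type*) [Fintype ι] : Measure (ι → ℂ) :=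
  Measure.pi fun _ => complexGaussian

instance (ι : Type*) [Fintype ι] : IsProbabilityMeasure (piComplexGaussian ι) := by
  unfold piComplexGaussian; infer_instance

variable {ι : Type*} [Fintype ι]

theorem piComplexGaussian_eq_withDensity :
    piComplexGaussian ι = volume.withDensity fun x : ι → ℂ =>
      ENNReal.ofReal ((Real.pi ^ Fintype.card ι)⁻¹ * Real.exp (-∑ i, ‖x i‖ ^ 2)) := by
  have : SigmaFinite ((volume : Measure ℂ).withDensity fun z : ℂ =>
      ENNReal.ofReal (Real.pi⁻¹ * Real.exp (-‖z‖ ^ 2))) := by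
    change SigmaFinite complexGaussian
    infer_instance
  have h := pi_withDensity (ι := ι) (volume : Measure ℂ) measurable_complexGaussian_density
  change piComplexGaussian ι = volume.withDensity _ at h
  rw [h]
  congr 1 with x
  rw [← ENNReal.ofReal_prod_of_nonneg fun i _ => by positivity, Finset.prod_mul_distrib,
    Finset.prod_const, ← Real.exp_sum, Finset.sum_neg_distrib, Finset.card_univ, inv_pow]

theorem memLp_apply_piComplexGaussian (a : ι) :
    MemLp (fun z : ι → ℂ => z a) 2 (piComplexGaussian ι) :=
  memLp_id_complexGaussian.comp_measurePreserving (measurePreserving_eval _ a)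

theorem integral_apply_piComplexGaussian (a : ι) :
    ∫ z, z a ∂(piComplexGaussian ι) = 0 := by
  have h := (measurePreserving_eval (fun _ : ι => complexGaussian) a)
  rw [← integral_id_complexGaussian, ← h.map_eq,
    integral_map h.measurable.aemeasurable (by fun_prop)]
  rfl

theorem integral_apply_mul_conj_piComplexGaussian [DecidableEq ι] (a b : ι) :
    ∫ z, z a * (starRingEnd ℂ) (z b) ∂(piComplexGaussian ι) = if a = b then 1 else 0 := by
  have h := fun a => (measurePreserving_eval (fun _ : ι => complexGaussian) a)
  split_ifs with hab
  · subst hab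
    have : ∀ z : ι → ℂ, z a * (starRingEnd ℂ) (z a) = ((‖z a‖ ^ 2 : ℝ) : ℂ) := fun z => by
      rw [Complex.mul_conj, Complex.normSq_eq_norm_sq]
    simp_rw [this]
    rw [integral_complex_ofReal]
    have h2 : ∫ z, ‖z a‖ ^ 2 ∂(piComplexGaussian ι) = 1 := by
      rw [← integral_norm_sq_complexGaussian, ← (h a).map_eq,
        integral_map (h a).measurable.aemeasurable (by fun_prop)]
      rfl
    rw [h2, Complex.ofReal_one]
  · have hind : iIndepFun (fun (i : ι) (z : ι → ℂ) => z i) (piComplexGaussian ι) :=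
      iIndepFun_pi (X := fun (_ : ι) (z : ℂ) => z) (μ := fun _ => complexGaussian)
        fun _ => aemeasurable_id
    have h2 := (hind.indepFun hab).comp measurable_id Complex.continuous_conj.measurable
    have h3 := h2.integral_fun_mul_eq_mul_integral
      (measurable_pi_apply a).aestronglyMeasurable (by
      exact (Complex.continuous_conj.measurable.comp (measurable_pi_apply b)).aestronglyMeasurable)
    refine h3.trans ?_
    simp only [Function.comp_def, id]
    rw [integral_apply_piComplexGaussian, zero_mul]

theorem memLp_affine_piComplexGaussian (c : ℂ) (o : ι → ℂ) :
    MemLp (fun z : ι → ℂ => c + ∑ a, o a * z a) 2 (piComplexGaussian ι) :=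
  (memLp_const c).add (memLp_finsetSum _ fun a _ => (memLp_apply_piComplexGaussian a).const_mul _)

theorem integrable_affine_mul_conj (c d : ℂ) (o r : ι → ℂ) :
    Integrable (fun z => (c + ∑ a, o a * z a) * (starRingEnd ℂ) (d + ∑ a, r a * z a))
      (piComplexGaussian ι) :=
  (memLp_affine_piComplexGaussian c o).integrable_mul (memLp_affine_piComplexGaussian d r).star

/-- The terms linear in `z` or its conjugate have mean zero, and orthonormality of the coordinates
leaves the diagonal of the quadratic part. -/
theorem integral_affine_mul_conj (c d : ℂ) (o r : ι → ℂ) :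
    ∫ z, (c + ∑ a, o a * z a) * (starRingEnd ℂ) (d + ∑ a, r a * z a) ∂(piComplexGaussian ι) =
      c * (starRingEnd ℂ) d + ∑ a, o a * (starRingEnd ℂ) (r a) := by
  classical
  have hi1 : ∀ a, Integrable (fun z : ι → ℂ => z a) (piComplexGaussian ι) := fun a =>
    (memLp_apply_piComplexGaussian a).integrable (by norm_num)
  have hi1' : ∀ a, Integrable (fun z : ι → ℂ => (starRingEnd ℂ) (z a)) (piComplexGaussian ι) :=
    fun a => (memLp_apply_piComplexGaussian a).star.integrable (by norm_num)
  have hi2 : ∀ a b, Integrable (fun z : ι → ℂ => z a * (starRingEnd ℂ) (z b))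
      (piComplexGaussian ι) := fun a b =>
    (memLp_apply_piComplexGaussian a).integrable_mul (memLp_apply_piComplexGaussian b).star
  have hexp : ∀ z : ι → ℂ, (c + ∑ a, o a * z a) * (starRingEnd ℂ) (d + ∑ a, r a * z a) =
      c * (starRingEnd ℂ) d + ∑ a, (starRingEnd ℂ) d * o a * z a +
        ∑ a, c * (starRingEnd ℂ) (r a) * (starRingEnd ℂ) (z a) +
        ∑ a, ∑ b, (o a * (starRingEnd ℂ) (r b)) * (z a * (starRingEnd ℂ) (z b)) := by
    intro z
    simp only [map_add, map_sum, map_mul, add_mul, mul_add, Finset.mul_sum,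
      Finset.sum_mul]
    have e1 : ∀ a, o a * z a * (starRingEnd ℂ) d = (starRingEnd ℂ) d * o a * z a :=
      fun a => by ring
    have e2 : ∀ a, c * ((starRingEnd ℂ) (r a) * (starRingEnd ℂ) (z a)) =
      c * (starRingEnd ℂ) (r a) * (starRingEnd ℂ) (z a) := fun a => by ring
    have e3 : ∀ a b, o a * z a * ((starRingEnd ℂ) (r b) * (starRingEnd ℂ) (z b)) =
      o a * (starRingEnd ℂ) (r b) * (z a * (starRingEnd ℂ) (z b)) := fun a b => by ring
    simp only [e1, e2, e3]
    rw [Finset.sum_add_distrib, add_assoc, add_assoc, add_assoc,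
      Finset.sum_comm (f := fun b a => o a * (starRingEnd ℂ) (r b) * (z a * (starRingEnd ℂ) (z b)))]
  simp_rw [hexp]
  have hI2 : Integrable (fun z : ι → ℂ => ∑ a, (starRingEnd ℂ) d * o a * z a)
    (piComplexGaussian ι) := integrable_finsetSum _ fun a _ => (hi1 a).const_mul _
  have hI3 : Integrable (fun z : ι → ℂ => ∑ a, c * (starRingEnd ℂ) (r a) * (starRingEnd ℂ) (z a))
    (piComplexGaussian ι) := integrable_finsetSum _ fun a _ => (hi1' a).const_mul _
  have hI4 : Integrable (fun z : ι → ℂ => ∑ a, ∑ b, (o a * (starRingEnd ℂ) (r b)) *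
    (z a * (starRingEnd ℂ) (z b))) (piComplexGaussian ι) :=
    integrable_finsetSum _ fun a _ => integrable_finsetSum _ fun b _ => (hi2 a b).const_mul _
  have hI12 : Integrable (fun z : ι → ℂ => c * (starRingEnd ℂ) d +
    ∑ a, (starRingEnd ℂ) d * o a * z a) (piComplexGaussian ι) := (integrable_const _).add hI2
  have hI123 : Integrable (fun z : ι → ℂ => c * (starRingEnd ℂ) d +
    ∑ a, (starRingEnd ℂ) d * o a * z a + ∑ a, c * (starRingEnd ℂ) (r a) * (starRingEnd ℂ) (z a))
    (piComplexGaussian ι) := hI12.add hI3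
  rw [integral_add hI123 hI4, integral_add hI12 hI3, integral_add (integrable_const _) hI2,
    integral_finsetSum _ fun a _ => (hi1 a).const_mul _,
    integral_finsetSum _ fun a _ => (hi1' a).const_mul _,
    integral_finsetSum _ fun a _ => integrable_finsetSum _ fun b _ => (hi2 a b).const_mul _]
  simp_rw [integral_finsetSum _ fun b _ => (hi2 _ b).const_mul _]
  simp only [integral_const_mul, integral_conj, integral_apply_piComplexGaussian,
    integral_apply_mul_conj_piComplexGaussian]
  simp

end Gaussian

/-! ### Second moment of a shifted Gaussian determinant -/

section DeterminantMoment

/-- Such permutations are exactly the permutations of the complement of `S`. -/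
theorem card_perm_fixing {κ : Type*} [Fintype κ] [DecidableEq κ] (S : Finset κ)
    [DecidablePred fun σ : Equiv.Perm κ => ∀ j ∈ S, σ j = j] :
    (Finset.univ.filter fun σ : Equiv.Perm κ => ∀ j ∈ S, σ j = j).card =
      (Fintype.card κ - S.card).factorial := by
  have e := Equiv.Perm.subtypeEquivSubtypePerm fun a : κ => a ∉ S
  have h1 := Fintype.card_congr e
  rw [Fintype.card_perm] at h1
  have h2 : Fintype.card {a : κ // a ∉ S} = Fintype.card κ - S.card := by
    rw [Fintype.card_subtype_compl, Fintype.card_coe]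
  rw [h2] at h1
  rw [h1, Fintype.card_subtype]
  congr 1
  ext σ
  simp

/-- The permanent of `J + x I`, with `J` the all-ones matrix. -/
theorem sum_perm_prod_one_add {m : ℕ} (x : ℝ) :
    ∑ σ : Equiv.Perm (Fin m), ∏ j, (1 + if σ j = j then x else 0) =
      m.factorial * ∑ k ∈ Finset.range (m + 1), x ^ k / k.factorial := by
  have h1 : ∀ (σ : Equiv.Perm (Fin m)) (S : Finset (Fin m)),
      (∏ j ∈ S, if σ j = j then x else 0) = if ∀ j ∈ S, σ j = j then x ^ S.card else 0 := by
    intro σ S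
    split_ifs with h
    · rw [Finset.prod_congr rfl fun j hj => if_pos (h j hj), Finset.prod_const]
    · push Not at h
      obtain ⟨j, hj, hne⟩ := h
      exact Finset.prod_eq_zero hj (if_neg hne)
  -- Each product expands over sets `S` of fixed points. Exchanging the sums leaves `(m - |S|)!
  -- x^|S|` for each `S`.
  simp_rw [Finset.prod_one_add, h1]
  rw [Finset.sum_comm]
  have h2 : ∀ S : Finset (Fin m), (∑ σ : Equiv.Perm (Fin m),
      if ∀ j ∈ S, σ j = j then x ^ S.card else 0) = (m - S.card).factorial * x ^ S.card := by
    intro S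
    rw [← Finset.sum_filter, Finset.sum_const, card_perm_fixing, Fintype.card_fin, nsmul_eq_mul]
  simp_rw [h2]
  rw [Finset.sum_powerset_apply_card fun k => ((m - k).factorial : ℝ) * x ^ k, Finset.card_univ,
    Fintype.card_fin, Finset.mul_sum]
  refine Finset.sum_congr rfl fun k hk => ?_
  have hk' : k ≤ m := by simpa [Nat.lt_succ_iff] using hk
  rw [nsmul_eq_mul, ← Nat.choose_mul_factorial_mul_factorial hk']
  push_cast
  field_simp

/-- The second moment of the determinant of a random matrix with independent columns. -/
theorem integral_norm_det_sq_eq_sum {E : Type*} [MeasurableSpace E] {m : ℕ} (ν : Measure E)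
    [IsProbabilityMeasure ν] (X : Fin m → E → Fin m → ℂ) (S : Fin m → Fin m → Fin m → ℂ)
    (hint : ∀ j i k, Integrable (fun e => X j e i * (starRingEnd ℂ) (X j e k)) ν)
    (hS : ∀ j i k, ∫ e, X j e i * (starRingEnd ℂ) (X j e k) ∂ν = S j i k) :
    Integrable (fun z : Fin m → E => ‖(Matrix.of fun i j => X j (z j) i).det‖ ^ 2)
      (Measure.pi fun _ => ν) ∧
    ((∫ z : Fin m → E, ‖(Matrix.of fun i j => X j (z j) i).det‖ ^ 2 ∂(Measure.pi fun _ => ν) : ℝ) :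
      ℂ) = ∑ σ : Equiv.Perm (Fin m), ∑ τ : Equiv.Perm (Fin m),
        ((Equiv.Perm.sign σ : ℤ) : ℂ) * ((Equiv.Perm.sign τ : ℤ) : ℂ) * ∏ j, S j (σ j) (τ j) := by
  have hexp : ∀ z : Fin m → E, ((‖(Matrix.of fun i j => X j (z j) i).det‖ ^ 2 : ℝ) : ℂ) =
      ∑ σ : Equiv.Perm (Fin m), ∑ τ : Equiv.Perm (Fin m),
        ((Equiv.Perm.sign σ : ℤ) : ℂ) * ((Equiv.Perm.sign τ : ℤ) : ℂ) *
          ∏ j, (X j (z j) (σ j) * (starRingEnd ℂ) (X j (z j) (τ j))) := by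
    intro z
    rw [← Complex.normSq_eq_norm_sq, ← Complex.mul_conj, Matrix.det_apply', map_sum,
      Finset.sum_mul_sum]
    refine Finset.sum_congr rfl fun σ _ => Finset.sum_congr rfl fun τ _ => ?_
    rw [Finset.prod_mul_distrib]
    simp only [Matrix.of_apply, map_mul, map_prod, map_intCast]
    ring
  have hI : ∀ σ τ : Equiv.Perm (Fin m), Integrable (fun z : Fin m → E =>
      ∏ j, (X j (z j) (σ j) * (starRingEnd ℂ) (X j (z j) (τ j)))) (Measure.pi fun _ => ν) :=
    fun σ τ => Integrable.fintype_prod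
      (f := fun j e => X j e (σ j) * (starRingEnd ℂ) (X j e (τ j))) fun j => hint j _ _
  have hIc : Integrable (fun z : Fin m → E =>
      ((‖(Matrix.of fun i j => X j (z j) i).det‖ ^ 2 : ℝ) : ℂ)) (Measure.pi fun _ => ν) := by
    simp_rw [hexp]
    exact integrable_finsetSum _ fun σ _ => integrable_finsetSum _ fun τ _ => (hI σ τ).const_mul _
  refine ⟨hIc.re, ?_⟩
  rw [← integral_complex_ofReal]
  simp_rw [hexp]
  rw [integral_finsetSum _ fun σ _ => integrable_finsetSum _ fun τ _ => (hI σ τ).const_mul _]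
  refine Finset.sum_congr rfl fun σ _ => ?_
  rw [integral_finsetSum _ fun τ _ => (hI σ τ).const_mul _]
  refine Finset.sum_congr rfl fun τ _ => ?_
  rw [integral_const_mul, integral_fintype_prod_eq_prod
    (f := fun j e => X j e (σ j) * (starRingEnd ℂ) (X j e (τ j)))]
  simp_rw [hS]

/-- The second moment of `det (c - O Z)` for a Gaussian matrix `Z` and a coisometry `O`. -/
theorem lintegral_norm_det_sub_sq {ι : Type*} [Fintype ι] {m : ℕ} (c : ℂ)
    (O : Matrix (Fin m) ι ℂ) (hO : O * O.conjTranspose = 1) :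
    ∫⁻ z : ι × Fin m → ℂ, ENNReal.ofReal
        (‖(Matrix.scalar (Fin m) c - O * Matrix.of fun i j => z (i, j)).det‖ ^ 2)
        ∂(piComplexGaussian (ι × Fin m)) =
      ENNReal.ofReal
        (m.factorial * ∑ k ∈ Finset.range (m + 1), (‖c‖ ^ 2) ^ k / k.factorial) := by
  classical
  -- Column `j` of `c - O Z` is an affine function of column `j` of `Z` alone, so the columns are
  -- independent. `S j` is the matrix of their second moments, computed from `O O* = 1`.
  let X : Fin m → (ι → ℂ) → Fin m → ℂ := fun j e i =>
    (if i = j then c else 0) + ∑ a, (-O i a) * e a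
  let S : Fin m → Fin m → Fin m → ℂ := fun j i k =>
    (if i = j then c else 0) * (starRingEnd ℂ) (if k = j then c else 0) + if i = k then 1 else 0
  have hdet : ∀ z : Fin m → ι → ℂ,
      (Matrix.scalar (Fin m) c - O * Matrix.of fun i j => z j i) =
        Matrix.of fun i j => X j (z j) i := by
    intro z
    ext i j
    simp [X, Matrix.mul_apply, Matrix.diagonal_apply, sub_eq_add_neg, Finset.sum_neg_distrib]
  obtain ⟨hint, hval⟩ := integral_norm_det_sq_eq_sum (piComplexGaussian ι) X S
    (fun j i k => integrable_affine_mul_conj _ _ _ _) (fun j i k => by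
      rw [integral_affine_mul_conj]
      have := congrFun (congrFun hO i) k
      simp only [Matrix.mul_apply, Matrix.conjTranspose_apply, Matrix.one_apply] at this
      simp only [S, map_neg, neg_mul_neg]
      rw [← this]; rfl)
  -- Where `σ j ≠ τ j`, at most one of the two equals `j`, so both terms of `S j (σ j) (τ j)`
  -- vanish. The double sum thus reduces to the permanent of `J + |c|² I`.
  have hoff : ∀ σ τ : Equiv.Perm (Fin m), τ ≠ σ → ∏ j, S j (σ j) (τ j) = 0 := by
    intro σ τ hne
    obtain ⟨j, hj⟩ : ∃ j, τ j ≠ σ j := by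
      by_contra h
      push Not at h
      exact hne (Equiv.ext h)
    refine Finset.prod_eq_zero (Finset.mem_univ j) ?_
    simp only [S, if_neg hj.symm, add_zero]
    by_cases h1 : σ j = j
    · have h2 : τ j ≠ j := fun h => hj (h.trans h1.symm)
      simp [h2]
    · simp [h1]
  have hdiag : ∀ σ : Equiv.Perm (Fin m), ∏ j, S j (σ j) (σ j) =
      ((∏ j, (1 + if σ j = j then ‖c‖ ^ 2 else 0) : ℝ) : ℂ) := by
    intro σ
    push_cast
    refine Finset.prod_congr rfl fun j _ => ?_
    by_cases h : σ j = j
    · simp [S, h, Complex.mul_conj, Complex.normSq_eq_norm_sq, add_comm]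
    · simp [S, h]
  have hsum : ∫ z : Fin m → ι → ℂ, ‖(Matrix.of fun i j => X j (z j) i).det‖ ^ 2
      ∂(Measure.pi fun _ => piComplexGaussian ι) =
      m.factorial * ∑ k ∈ Finset.range (m + 1), (‖c‖ ^ 2) ^ k / k.factorial := by
    rw [← sum_perm_prod_one_add, ← Complex.ofReal_inj, hval, Complex.ofReal_sum]
    refine Finset.sum_congr rfl fun σ _ => ?_
    rw [Finset.sum_eq_single σ (fun τ _ hτ => by rw [hoff σ τ hτ, mul_zero]) (by simp), hdiag,
      ← Int.cast_mul, ← Units.val_mul, Int.units_mul_self]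
    simp
  rw [← hsum, ofReal_integral_eq_lintegral_ofReal hint
    (Eventually.of_forall fun z => by positivity)]
  have hmp := measurePreserving_curry_swap (ι := ι) (κ := Fin m) complexGaussian
  have hmeas : Measurable fun z : ι × Fin m → ℂ => ENNReal.ofReal
      (‖(Matrix.scalar (Fin m) c - O * Matrix.of fun i j => z (i, j)).det‖ ^ 2) := by
    refine Continuous.measurable (ENNReal.continuous_ofReal.comp ?_)
    refine (Continuous.norm (Continuous.matrix_det ?_)).pow 2
    refine continuous_const.sub (continuous_const.matrix_mul ?_)
    exact continuous_matrix fun i j => continuous_apply _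
  refine (hmp.lintegral_comp hmeas).symm.trans ?_
  refine lintegral_congr fun z => ?_
  rw [← hdet]

end DeterminantMoment

/-! ### Eigenpairs as a chart for the first column -/

section EigenpairChart

variable {m : ℕ}

/-- The square matrix with first column `c` and remaining columns `U`. -/
def bordered (c : Fin (m + 1) → ℂ) (U : Fin (m + 1) × Fin m → ℂ) :
    Matrix (Fin (m + 1)) (Fin (m + 1)) ℂ :=
  Matrix.of fun i => Fin.cons (c i) fun j => U (i, j)

/-- The vector `(1, y)` where `y` is the tail of `p`. -/
def affineVector (p : Fin (m + 1) → ℂ) : Fin (m + 1) → ℂ :=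
  Fin.cons 1 fun j => p j.succ

/-- For `p = (l, y)`, the unique `c` such that `(1, y)` is an eigenvector of `bordered c U` with
eigenvalue `l`. -/
def eigenChart (U : Fin (m + 1) × Fin m → ℂ) (p : Fin (m + 1) → ℂ) : Fin (m + 1) → ℂ :=
  fun i => p 0 * affineVector p i - ∑ j, U (i, j) * p j.succ

/-- The complex Jacobian matrix of `eigenChart U`. -/
def eigenChartJacobian (U : Fin (m + 1) × Fin m → ℂ) (p : Fin (m + 1) → ℂ) :
    Matrix (Fin (m + 1)) (Fin (m + 1)) ℂ :=
  Matrix.of fun i => Fin.cons (affineVector p i)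
    fun j => (if i = j.succ then p 0 else 0) - U (i, j)

/-- The matrix `[-y, I]`. -/
def shearRows (y : Fin m → ℂ) : Matrix (Fin m) (Fin (m + 1)) ℂ :=
  Matrix.of fun i => Fin.cons (-y i) fun k => if i = k then 1 else 0

theorem bordered_mulVec_affineVector {c : Fin (m + 1) → ℂ} {U : Fin (m + 1) × Fin m → ℂ}
    {p : Fin (m + 1) → ℂ} (h : eigenChart U p = c) :
    (bordered c U).mulVec (affineVector p) = p 0 • affineVector p := by
  ext i
  rw [← h]
  simp [Matrix.mulVec, dotProduct, Fin.sum_univ_succ, bordered, eigenChart, affineVector]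

theorem eigenChartJacobian_mulVec_apply (U : Fin (m + 1) × Fin m → ℂ) (p v : Fin (m + 1) → ℂ)
    (i : Fin (m + 1)) :
    (eigenChartJacobian U p).mulVec v i =
      affineVector p i * v 0 + p 0 * (Fin.cons 0 (fun j => v j.succ) : Fin (m + 1) → ℂ) i -
        ∑ j, U (i, j) * v j.succ := by
  simp only [Matrix.mulVec, dotProduct, Fin.sum_univ_succ, eigenChartJacobian, Matrix.of_apply,
    Fin.cons_zero, Fin.cons_succ, sub_mul, Finset.sum_sub_distrib]
  have : ∑ j : Fin m, (if i = j.succ then p 0 else 0) * v j.succ =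
      p 0 * (Fin.cons 0 (fun j => v j.succ) : Fin (m + 1) → ℂ) i := by
    refine Fin.cases ?_ (fun k => ?_) i
    · simp [Fin.succ_ne_zero, eq_comm]
    · simp
  rw [this]
  ring

theorem hasFDerivAt_eigenChart (U : Fin (m + 1) × Fin m → ℂ) (p : Fin (m + 1) → ℂ) :
    HasFDerivAt (eigenChart U)
      (((eigenChartJacobian U p).toLin'.toContinuousLinearMap).restrictScalars ℝ) p := by
  have h : HasFDerivAt (𝕜 := ℂ) (eigenChart U)
      (eigenChartJacobian U p).toLin'.toContinuousLinearMap p := by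
    rw [hasFDerivAt_pi']
    intro i
    have hx : HasFDerivAt (𝕜 := ℂ) (fun q : Fin (m + 1) → ℂ => affineVector q i)
        ((Fin.cons 0 (fun j => ContinuousLinearMap.proj j.succ) :
          Fin (m + 1) → ((Fin (m + 1) → ℂ) →L[ℂ] ℂ)) i) p := by
      refine Fin.cases ?_ (fun k => ?_) i
      · simpa [affineVector] using hasFDerivAt_const (1 : ℂ) p
      · simpa [affineVector] using hasFDerivAt_apply (𝕜 := ℂ) k.succ p
    have hs : HasFDerivAt (𝕜 := ℂ) (fun q : Fin (m + 1) → ℂ => ∑ j, U (i, j) * q j.succ)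
        (∑ j : Fin m, U (i, j) • (ContinuousLinearMap.proj j.succ :
          (Fin (m + 1) → ℂ) →L[ℂ] ℂ)) p :=
      HasFDerivAt.fun_sum fun j _ => (hasFDerivAt_apply (𝕜 := ℂ) j.succ p).const_mul _
    have h0 := ((hasFDerivAt_apply (𝕜 := ℂ) (0 : Fin (m + 1)) p).mul hx).sub hs
    refine h0.congr_fderiv ?_
    ext v
    simp only [ContinuousLinearMap.comp_apply, LinearMap.coe_toContinuousLinearMap',
      Matrix.toLin'_apply, ContinuousLinearMap.proj_apply, eigenChartJacobian_mulVec_apply,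
      sub_apply, add_apply, smul_apply,
      smul_eq_mul, sum_apply]
    have : ((Fin.cons 0 (fun j => ContinuousLinearMap.proj j.succ) :
        Fin (m + 1) → ((Fin (m + 1) → ℂ) →L[ℂ] ℂ)) i) v =
        (Fin.cons 0 (fun j => v j.succ) : Fin (m + 1) → ℂ) i := by
      refine Fin.cases ?_ (fun k => ?_) i <;> simp
    rw [this]
    ring
  exact h.restrictScalars ℝ

theorem det_restrictScalars_toLin' {ι : Type*} [Fintype ι] [DecidableEq ι] (A : Matrix ι ι ℂ) :
    ((A.toLin'.toContinuousLinearMap).restrictScalars ℝ).det = ‖A.det‖ ^ 2 := by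
  have : ((A.toLin'.toContinuousLinearMap).restrictScalars ℝ).det =
      LinearMap.det (A.toLin'.restrictScalars ℝ) := rfl
  rw [this, LinearMap.det_restrictScalars, LinearMap.det_toLin', Algebra.norm_complex_eq]
  exact Complex.normSq_eq_norm_sq _

/-- Subtracting `y i` times the top row from row `i + 1` clears the first column below its entry
`1`, and the lower right block becomes `l - [-y, I] U`. -/
theorem det_eigenChartJacobian (U : Fin (m + 1) × Fin m → ℂ) (p : Fin (m + 1) → ℂ) :
    (eigenChartJacobian U p).det =
      (Matrix.scalar (Fin m) (p 0) -
        shearRows (fun j => p j.succ) * Matrix.of fun i j => U (i, j)).det := by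
  let T := Matrix.scalar (Fin m) (p 0) -
        shearRows (fun j => p j.succ) * Matrix.of fun i j => U (i, j)
  let B : Matrix (Fin (m + 1)) (Fin (m + 1)) ℂ := Matrix.of
    (Fin.cons (eigenChartJacobian U p 0) fun i => (Fin.cons 0 (T i) : Fin (m + 1) → ℂ))
  have hB : (eigenChartJacobian U p).det = B.det := by
    refine Matrix.det_eq_of_forall_row_eq_smul_add_const
      (Fin.cons 0 fun j => p j.succ) 0 (by simp) fun i j => ?_
    refine Fin.cases ?_ (fun i => ?_) i
    · simp [B]
    · refine Fin.cases ?_ (fun j => ?_) j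
      · simp [B, eigenChartJacobian, affineVector]
      · simp [B, T, eigenChartJacobian, shearRows, Matrix.mul_apply, Fin.sum_univ_succ,
          Matrix.diagonal_apply, (Fin.succ_ne_zero _).symm]
        ring
  rw [hB, Matrix.det_succ_column_zero, Fin.sum_univ_succ]
  have : (B.submatrix (Fin.succAbove 0) Fin.succ) = T := by
    ext i j
    simp [B]
  rw [this]
  simp [B, eigenChartJacobian, affineVector, T]

/-- At fixed eigenvalue the chart is affine in `y`, so the difference of two such points lies in the
kernel of the Jacobian. -/
theorem eigenChart_injOn_fiber {U : Fin (m + 1) × Fin m → ℂ} {p q : Fin (m + 1) → ℂ}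
    (hpq : eigenChart U p = eigenChart U q) (h0 : p 0 = q 0)
    (hdet : (eigenChartJacobian U p).det ≠ 0) : p = q := by
  have hv : (eigenChartJacobian U p).mulVec (q - p) = 0 := by
    ext i
    rw [eigenChartJacobian_mulVec_apply]
    have hi := congrFun hpq i
    simp only [eigenChart, ← h0] at hi
    have hx : (Fin.cons 0 (fun j => (q - p) j.succ) : Fin (m + 1) → ℂ) i =
        affineVector q i - affineVector p i := by
      refine Fin.cases ?_ (fun k => ?_) i <;> simp [affineVector]
    rw [hx]
    simp only [Pi.sub_apply, h0, sub_self, mul_zero, zero_add, mul_sub, Finset.sum_sub_distrib,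
      Pi.zero_apply]
    rw [h0] at hi
    linear_combination -hi
  have := Matrix.eq_zero_of_mulVec_eq_zero hdet hv
  exact (sub_eq_zero.1 this).symm

theorem isRoot_charpoly_of_mulVec_eq {n : ℕ} {A : Matrix (Fin n) (Fin n) ℂ} {v : Fin n → ℂ}
    {z : ℂ} (hv : v ≠ 0) (h : A.mulVec v = z • v) : z ∈ A.charpoly.roots := by
  rw [Polynomial.mem_roots (Matrix.charpoly_monic A).ne_zero, Polynomial.IsRoot,
    Matrix.eval_charpoly, ← Matrix.exists_mulVec_eq_zero_iff]
  refine ⟨v, hv, ?_⟩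
  rw [Matrix.sub_mulVec, h]
  ext i
  simp

/-- The number of eigenvalues of `A` in `V`, counted with multiplicity. -/
noncomputable def eigenvalueCount {n : ℕ} (A : Matrix (Fin n) (Fin n) ℂ) (V : Set ℂ) : ℝ≥0∞ :=
  (A.charpoly.roots.map fun z => V.indicator 1 z).sum

theorem sum_indicator_le_eigenvalueCount {n : ℕ} (A : Matrix (Fin n) (Fin n) ℂ) (V : Set ℂ)
    (t : Finset ℂ) (ht : ∀ z ∈ t, z ∈ A.charpoly.roots) :
    ∑ z ∈ t, V.indicator 1 z ≤ eigenvalueCount A V := by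
  classical
  rw [eigenvalueCount, Finset.sum_multiset_map_count]
  refine (Finset.sum_le_sum_of_subset fun z hz => Multiset.mem_toFinset.2 (ht z hz)).trans
    (Finset.sum_le_sum fun z hz => ?_)
  have h1 : 1 ≤ A.charpoly.roots.count z :=
    Multiset.one_le_count_iff_mem.2 (Multiset.mem_toFinset.1 hz)
  calc V.indicator (1 : ℂ → ℝ≥0∞) z = 1 • V.indicator (1 : ℂ → ℝ≥0∞) z := (one_smul _ _).symm
    _ ≤ _ := nsmul_le_nsmul_left zero_le h1

/-- Regular points over `c` give distinct eigenvalues of the matrix, so the fibre sum in the area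
formula is at most the eigenvalue count. Eigenvectors with vanishing first coordinate and multiple
eigenvalues only help the inequality. -/
theorem lintegral_eigenChart_le (U : Fin (m + 1) × Fin m → ℂ) (V : Set ℂ) {s : ℝ} (hs : s ≠ 0)
    (g : (Fin (m + 1) → ℂ) → ℝ≥0∞) :
    ∫⁻ p : Fin (m + 1) → ℂ, ENNReal.ofReal (‖(Matrix.scalar (Fin m) (p 0) -
        shearRows (fun j => p j.succ) * Matrix.of fun i j => U (i, j)).det‖ ^ 2) *
          (V.indicator 1 (s • p 0) * g (eigenChart U p)) ≤
      ∫⁻ c, eigenvalueCount (s • bordered c U) V * g c := by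
  classical
  have hmeas : Measurable fun p : Fin (m + 1) → ℂ =>
      ((eigenChartJacobian U p).toLin'.toContinuousLinearMap).restrictScalars ℝ := by
    have : (fun p : Fin (m + 1) → ℂ =>
        ((eigenChartJacobian U p).toLin'.toContinuousLinearMap).restrictScalars ℝ) =
        fderiv ℝ (eigenChart U) := funext fun p => (hasFDerivAt_eigenChart U p).fderiv.symm
    rw [this]
    exact measurable_fderiv ℝ _
  have key := lintegral_abs_det_fderiv_mul_le_of_forall_fiber
    (volume : Measure (Fin (m + 1) → ℂ)) (hasFDerivAt_eigenChart U) hmeas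
    (h := fun p => V.indicator 1 (s • p 0) * g (eigenChart U p))
    (H := fun c => eigenvalueCount (s • bordered c U) V * g c) ?_
  · refine le_trans (le_of_eq (lintegral_congr fun p => ?_)) key
    rw [det_restrictScalars_toLin', det_eigenChartJacobian, abs_of_nonneg (by positivity)]
  · intro c t ht
    have ht1 : ∀ p ∈ t, eigenChart U p = c := fun p hp => (ht p hp).1
    have ht2 : ∀ p ∈ t, (eigenChartJacobian U p).det ≠ 0 := fun p hp h0 => (ht p hp).2 (by
      rw [det_restrictScalars_toLin', h0]; simp)
    have hinj : Set.InjOn (fun p : Fin (m + 1) → ℂ => s • p 0) t := by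
      intro p hp q hq hpq
      exact eigenChart_injOn_fiber ((ht1 p hp).trans (ht1 q hq).symm)
        (smul_right_injective ℂ hs hpq) (ht2 p hp)
    calc ∑ p ∈ t, V.indicator 1 (s • p 0) * g (eigenChart U p)
        = (∑ p ∈ t, V.indicator 1 (s • p 0)) * g c := by
          rw [Finset.sum_mul]
          exact Finset.sum_congr rfl fun p hp => by rw [ht1 p hp]
      _ = (∑ z ∈ t.image fun p => s • p 0, V.indicator 1 z) * g c := by
          rw [Finset.sum_image hinj]
      _ ≤ eigenvalueCount (s • bordered c U) V * g c := by
          gcongr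
          refine sum_indicator_le_eigenvalueCount _ _ _ fun z hz => ?_
          obtain ⟨p, hp, rfl⟩ := Finset.mem_image.1 hz
          refine isRoot_charpoly_of_mulVec_eq (v := affineVector p) (fun h => ?_) ?_
          · simpa [affineVector] using congrFun h 0
          · rw [Matrix.smul_mulVec, bordered_mulVec_affineVector (ht1 p hp), smul_assoc]

end EigenpairChart

/-! ### Completing the square in the rows of `U` -/

section GaussianSubstitution

theorem lintegral_comp_affine {E : Type*} [NormedAddCommGroup E] [NormedSpace ℝ E]
    [FiniteDimensional ℝ E] [MeasurableSpace E] [BorelSpace E] (μ : Measure E)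
    [μ.IsAddHaarMeasure] {T : E →ₗ[ℝ] E} (hT : LinearMap.det T ≠ 0) (a : E) {F : E → ℝ≥0∞}
    (hF : Measurable F) :
    ∫⁻ x, F x ∂μ = ENNReal.ofReal |LinearMap.det T| * ∫⁻ x, F (a + T x) ∂μ := by
  have hTm : Measurable T := (LinearMap.continuous_of_finiteDimensional T).measurable
  have h1 : ∫⁻ x, F (a + T x) ∂μ = ENNReal.ofReal |(LinearMap.det T)⁻¹| * ∫⁻ x, F x ∂μ := by
    rw [← lintegral_map (f := fun x => F (a + x)) (by fun_prop) hTm,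
      Measure.map_linearMap_addHaar_eq_smul_addHaar μ hT, lintegral_smul_measure,
      lintegral_add_left_eq_self, smul_eq_mul]
  rw [h1, ← mul_assoc, ← ENNReal.ofReal_mul (abs_nonneg _), ← abs_mul, mul_inv_cancel₀ hT]
  simp

/-- The Lebesgue density of `piComplexGaussian ι`. -/
noncomputable def gaussianDensity {ι : Type*} [Fintype ι] (x : ι → ℂ) : ℝ≥0∞ :=
  ENNReal.ofReal ((Real.pi ^ Fintype.card ι)⁻¹ * Real.exp (-∑ i, ‖x i‖ ^ 2))

theorem measurable_gaussianDensity {ι : Type*} [Fintype ι] :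
    Measurable (gaussianDensity : (ι → ℂ) → ℝ≥0∞) := by
  unfold gaussianDensity; fun_prop

theorem lintegral_piComplexGaussian {ι : Type*} [Fintype ι] (F : (ι → ℂ) → ℝ≥0∞)
    (hF : Measurable F) :
    ∫⁻ x, F x ∂(piComplexGaussian ι) = ∫⁻ x, gaussianDensity x * F x := by
  rw [piComplexGaussian_eq_withDensity]
  exact lintegral_withDensity_eq_lintegral_mul _ measurable_gaussianDensity hF

variable {m : ℕ}

/-- The squared norm of the vector `(1, y)`. -/
noncomputable def affineNormSq (y : Fin m → ℂ) : ℝ := 1 + ∑ j, ‖y j‖ ^ 2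

theorem affineNormSq_pos (y : Fin m → ℂ) : 0 < affineNormSq y := by
  unfold affineNormSq; positivity

/-- The coefficient `c` for which `1 - c y y*` is the inverse square root of `1 + y y*`. -/
noncomputable def rootCoeff (y : Fin m → ℂ) : ℝ :=
  (√(affineNormSq y) * (√(affineNormSq y) + 1))⁻¹

/-- The inverse square root of `1 + y y*`. -/
noncomputable def invSqrtShear (y : Fin m → ℂ) : Matrix (Fin m) (Fin m) ℂ :=
  1 - (rootCoeff y : ℂ) • Matrix.vecMulVec y (star y)

theorem sum_mul_conj_eq (y : Fin m → ℂ) :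
    ∑ j, y j * (starRingEnd ℂ) (y j) = ((√(affineNormSq y) : ℝ) : ℂ) ^ 2 - 1 := by
  rw [← Complex.ofReal_pow, Real.sq_sqrt (affineNormSq_pos y).le]
  simp [affineNormSq, Complex.mul_conj, Complex.normSq_eq_norm_sq]

/-- The determinant of the rank one perturbation is `1 - rootCoeff y * |y|²`. With `q = √(1 + |y|²)`
this is `1 - (q² - 1) / (q (q + 1)) = 1 / q`. -/
theorem det_invSqrtShear (y : Fin m → ℂ) :
    (invSqrtShear y).det = ((√(affineNormSq y) : ℝ) : ℂ)⁻¹ := by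
  have hq : 0 < √(affineNormSq y) := Real.sqrt_pos.2 (affineNormSq_pos y)
  have h1 : invSqrtShear y = 1 + Matrix.replicateCol Unit (-(rootCoeff y : ℂ) • y) *
      Matrix.replicateRow Unit (star y) := by
    ext i j
    simp [invSqrtShear, Matrix.vecMulVec_apply, Matrix.mul_apply, sub_eq_add_neg, mul_assoc]
  rw [h1, Matrix.det_one_add_replicateCol_mul_replicateRow]
  have h2 : star y ⬝ᵥ (-(rootCoeff y : ℂ) • y) = -(rootCoeff y : ℂ) *
      ∑ j, y j * (starRingEnd ℂ) (y j) := by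
    simp only [dotProduct, Pi.star_apply, Pi.smul_apply, smul_eq_mul, Finset.mul_sum]
    exact Finset.sum_congr rfl fun j _ => by simp; ring
  rw [h2, sum_mul_conj_eq, rootCoeff]
  have hq1 : ((√(affineNormSq y) : ℝ) : ℂ) ≠ 0 := by exact_mod_cast hq.ne'
  have hq2 : ((√(affineNormSq y) : ℝ) : ℂ) + 1 ≠ 0 := by exact_mod_cast (by positivity)
  push_cast
  field_simp
  ring

theorem shearRows_mul_conjTranspose (y : Fin m → ℂ) :
    shearRows y * (shearRows y).conjTranspose = 1 + Matrix.vecMulVec y (star y) := by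
  ext i j
  simp [shearRows, Matrix.mul_apply, Fin.sum_univ_succ, Matrix.vecMulVec_apply, Matrix.one_apply,
    add_comm]

theorem invSqrtShear_conjTranspose (y : Fin m → ℂ) :
    (invSqrtShear y).conjTranspose = invSqrtShear y := by
  ext i j
  simp [invSqrtShear, Matrix.vecMulVec_apply, Matrix.one_apply, eq_comm, mul_comm]

/-- With `R` the inverse square root, the product is `R (1 + y y*) R`. Since `(y y*)² = (q² - 1) y
y*`, everything reduces to one scalar identity in `q`. -/
theorem invSqrtShear_mul_shearRows_coisometry (y : Fin m → ℂ) :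
    (invSqrtShear y * shearRows y) * (invSqrtShear y * shearRows y).conjTranspose = 1 := by
  have hq : 0 < √(affineNormSq y) := Real.sqrt_pos.2 (affineNormSq_pos y)
  rw [Matrix.conjTranspose_mul, invSqrtShear_conjTranspose, Matrix.mul_assoc,
    ← Matrix.mul_assoc (shearRows y), shearRows_mul_conjTranspose, invSqrtShear]
  set Y := Matrix.vecMulVec y (star y) with hY
  set q : ℂ := ((√(affineNormSq y) : ℝ) : ℂ) with hqdef
  have hq1 : q ≠ 0 := by rw [hqdef]; exact_mod_cast hq.ne'
  have hq2 : q + 1 ≠ 0 := by rw [hqdef]; exact_mod_cast (by positivity)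
  have hYY : Y * Y = (q ^ 2 - 1) • Y := by
    rw [hY, Matrix.vecMulVec_mul_vecMulVec, ← sum_mul_conj_eq]
    ext i j
    simp [Matrix.vecMulVec_apply, dotProduct, mul_comm]
    ring
  have hc : (rootCoeff y : ℂ) = (q * (q + 1))⁻¹ := by
    simp [rootCoeff, hqdef]
  rw [hc]
  have : (1 - (q * (q + 1))⁻¹ • Y) * ((1 + Y) * (1 - (q * (q + 1))⁻¹ • Y)) =
      1 + (1 - 2 * (q * (q + 1))⁻¹) • Y + ((q * (q + 1))⁻¹ ^ 2 - 2 * (q * (q + 1))⁻¹) • (Y * Y) +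
        ((q * (q + 1))⁻¹ ^ 2) • (Y * Y * Y) := by
    simp only [sub_mul, mul_sub, add_mul, mul_add, one_mul, mul_one, smul_mul_assoc,
      mul_smul_comm, smul_smul, Matrix.mul_assoc, sub_smul, one_smul, sq, two_mul, add_smul,
      smul_sub, smul_add]
    abel
  rw [this, hYY, smul_mul_assoc, hYY]
  simp only [smul_smul, add_assoc, ← add_smul]
  have h0 : 1 - 2 * (q * (q + 1))⁻¹ + (((q * (q + 1))⁻¹ ^ 2 - 2 * (q * (q + 1))⁻¹) * (q ^ 2 - 1) +
      (q * (q + 1))⁻¹ ^ 2 * ((q ^ 2 - 1) * (q ^ 2 - 1))) = 0 := by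
    field_simp
    ring
  rw [h0, zero_smul, add_zero]

/-- The form `|t - u y|² + |u|²` in a row `u` has Hessian `1 + y y*`, minimiser `t y* / (1 + |y|²)`
and minimum `|t|² / (1 + |y|²)`. The inverse square root whitens the deviation from the minimiser.
-/
theorem norm_sq_row_substitution (y z : Fin m → ℂ) (t : ℂ) :
    ‖t - ∑ j, (t * (starRingEnd ℂ) (y j) / affineNormSq y + ∑ k, z k * invSqrtShear y k j) * y j‖ ^ 2
      + ∑ j, ‖t * (starRingEnd ℂ) (y j) / affineNormSq y + ∑ k, z k * invSqrtShear y k j‖ ^ 2 =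
      ‖t‖ ^ 2 / affineNormSq y + ∑ j, ‖z j‖ ^ 2 := by
  have hq : 0 < √(affineNormSq y) := Real.sqrt_pos.2 (affineNormSq_pos y)
  have hqsq : affineNormSq y = √(affineNormSq y) ^ 2 := (Real.sq_sqrt (affineNormSq_pos y).le).symm
  set q : ℂ := ((√(affineNormSq y) : ℝ) : ℂ) with hqdef
  have hq1 : q ≠ 0 := by rw [hqdef]; exact_mod_cast hq.ne'
  have hq2 : q + 1 ≠ 0 := by rw [hqdef]; exact_mod_cast (by positivity)
  have hc : (rootCoeff y : ℂ) = (q * (q + 1))⁻¹ := by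
    simp [rootCoeff, hqdef]
  have hN : (affineNormSq y : ℂ) = q ^ 2 := by rw [hqdef]; exact_mod_cast hqsq
  set w := ∑ k, z k * y k with hw
  set α := t / q ^ 2 - (q * (q + 1))⁻¹ * w with hα
  -- The shift and the rank one correction are both multiples of `y*`, so only the scalars `t`, `w`,
  -- `q` enter the computation.
  have hu : ∀ j, t * (starRingEnd ℂ) (y j) / affineNormSq y + ∑ k, z k * invSqrtShear y k j =
      z j + α * (starRingEnd ℂ) (y j) := by
    intro j
    have : ∑ k, z k * invSqrtShear y k j =
        z j - (q * (q + 1))⁻¹ * w * (starRingEnd ℂ) (y j) := by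
      simp only [invSqrtShear, Matrix.sub_apply, Matrix.smul_apply, Matrix.vecMulVec_apply,
        Matrix.one_apply, mul_sub, Finset.sum_sub_distrib, hc, smul_eq_mul, Pi.star_apply,
        mul_ite, mul_one, mul_zero, Finset.sum_ite_eq', Finset.mem_univ, if_true, hw,
        Finset.mul_sum, Finset.sum_mul]
      congr 1
      exact Finset.sum_congr rfl fun k _ => by simp; ring
    rw [this, hN, hα]
    ring
  simp_rw [hu]
  have hs := sum_mul_conj_eq y
  rw [← hqdef] at hs
  have huy : ∑ j, (z j + α * (starRingEnd ℂ) (y j)) * y j = w + α * (q ^ 2 - 1) := by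
    rw [← hs, hw, Finset.mul_sum, ← Finset.sum_add_distrib]
    exact Finset.sum_congr rfl fun j _ => by ring
  have hconjq : (starRingEnd ℂ) q = q := Complex.conj_ofReal _
  have huu : ∑ j, (z j + α * (starRingEnd ℂ) (y j)) *
      (starRingEnd ℂ) (z j + α * (starRingEnd ℂ) (y j)) =
      ∑ j, z j * (starRingEnd ℂ) (z j) + (starRingEnd ℂ) α * w + α * (starRingEnd ℂ) w +
        α * (starRingEnd ℂ) α * (q ^ 2 - 1) := by
    rw [← hs, hw, map_sum, Finset.mul_sum, Finset.mul_sum, Finset.mul_sum,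
      ← Finset.sum_add_distrib, ← Finset.sum_add_distrib, ← Finset.sum_add_distrib]
    exact Finset.sum_congr rfl fun j _ => by simp only [map_add, map_mul, Complex.conj_conj]; ring
  have hns : ∀ x : ℂ, ((‖x‖ ^ 2 : ℝ) : ℂ) = x * (starRingEnd ℂ) x := fun x => by
    rw [Complex.mul_conj, Complex.normSq_eq_norm_sq]
  rw [huy, ← Complex.ofReal_inj, Complex.ofReal_add, Complex.ofReal_add, Complex.ofReal_div,
    Complex.ofReal_sum, Complex.ofReal_sum]
  simp_rw [hns]
  rw [huu, hN, hα]
  simp only [map_sub, map_add, map_mul, map_div₀, map_inv₀, map_pow, map_one, hconjq]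
  field_simp
  ring

end GaussianSubstitution

/-! ### Integrating out the matrix entries and the eigenvector -/

section EigenvalueDensity

variable {m : ℕ}

theorem sum_norm_sq_affineVector (p : Fin (m + 1) → ℂ) :
    ∑ i, ‖affineVector p i‖ ^ 2 = affineNormSq fun j => p j.succ := by
  simp [affineVector, affineNormSq, Fin.sum_univ_succ]

/-- Right multiplication of an `(m + 1) × m` matrix by `invSqrtShear y`. -/
noncomputable def rowSubstitution (y : Fin m → ℂ) :
    (Fin (m + 1) × Fin m → ℂ) →ₗ[ℝ] (Fin (m + 1) × Fin m → ℂ) :=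
  (Matrix.toLin' (Matrix.kronecker (1 : Matrix (Fin (m + 1)) (Fin (m + 1)) ℂ)
    (invSqrtShear y).transpose)).restrictScalars ℝ

theorem rowSubstitution_apply (y : Fin m → ℂ) (z : Fin (m + 1) × Fin m → ℂ) (i : Fin (m + 1))
    (j : Fin m) : rowSubstitution y z (i, j) = ∑ k, z (i, k) * invSqrtShear y k j := by
  simp only [rowSubstitution, LinearMap.coe_restrictScalars, Matrix.toLin'_apply, Matrix.mulVec,
    dotProduct, Fintype.sum_prod_type, Matrix.kronecker, Matrix.kroneckerMap_apply,
    Matrix.transpose_apply, Matrix.one_apply]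
  rw [Finset.sum_eq_single i (fun b _ hb => by simp [hb.symm]) (by simp)]
  exact Finset.sum_congr rfl fun k _ => by simp [mul_comm]

theorem det_rowSubstitution (y : Fin m → ℂ) :
    LinearMap.det (rowSubstitution y) = (affineNormSq y ^ (m + 1))⁻¹ := by
  have h := det_restrictScalars_toLin' (Matrix.kronecker
    (1 : Matrix (Fin (m + 1)) (Fin (m + 1)) ℂ) (invSqrtShear y).transpose)
  refine Eq.trans h ?_
  rw [Matrix.kronecker, Matrix.det_kronecker, Matrix.det_transpose, det_invSqrtShear]
  simp only [Matrix.det_one, one_pow, one_mul, Fintype.card_fin, norm_pow, norm_inv,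
    Complex.norm_real, Real.norm_eq_abs, abs_of_nonneg (Real.sqrt_nonneg _)]
  rw [← pow_mul, mul_comm, pow_mul, inv_pow, Real.sq_sqrt (affineNormSq_pos y).le, inv_pow]

theorem det_scalar_sub_mul_comm {n : ℕ} (c : ℂ) (A B : Matrix (Fin n) (Fin n) ℂ) :
    (Matrix.scalar (Fin n) c - A * B).det = (Matrix.scalar (Fin n) c - B * A).det := by
  rw [← Matrix.eval_charpoly, ← Matrix.eval_charpoly, Matrix.charpoly_mul_comm]

theorem measurable_det_scalar_sub_shearRows (V : Set ℂ) (hV : MeasurableSet V) (s : ℝ) :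
    Measurable fun x : (Fin (m + 1) → ℂ) × (Fin (m + 1) × Fin m → ℂ) =>
      ENNReal.ofReal (‖(Matrix.scalar (Fin m) (x.1 0) -
        shearRows (fun j => x.1 j.succ) * Matrix.of fun i j => x.2 (i, j)).det‖ ^ 2) *
          (V.indicator 1 (s • x.1 0) * gaussianDensity (eigenChart x.2 x.1)) := by
  refine Measurable.mul ?_ (Measurable.mul ?_ ?_)
  · refine Continuous.measurable (ENNReal.continuous_ofReal.comp ?_)
    refine (Continuous.norm (Continuous.matrix_det ?_)).pow 2
    refine continuous_matrix fun i j => ?_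
    simp only [Matrix.sub_apply, Matrix.mul_apply, shearRows, Matrix.of_apply, Fin.sum_univ_succ,
      Fin.cons_zero, Fin.cons_succ, Matrix.scalar_apply, Matrix.diagonal_apply]
    by_cases h : i = j
    · simp only [h, if_true]; fun_prop
    · simp only [h, if_false]; fun_prop
  · exact ((measurable_one.indicator hV).comp (by fun_prop))
  · refine measurable_gaussianDensity.comp (measurable_pi_lambda _ fun i => ?_)
    unfold eigenChart affineVector
    refine Fin.cases ?_ (fun k => ?_) i
    · simp only [Fin.cons_zero]; fun_prop
    · simp only [Fin.cons_succ]; fun_prop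

/-- Integrating out all entries of the matrix given one eigenvalue and its eigenvector. -/
theorem lintegral_det_mul_gaussianDensity (p : Fin (m + 1) → ℂ) :
    ∫⁻ U : Fin (m + 1) × Fin m → ℂ, gaussianDensity U *
        (ENNReal.ofReal (‖(Matrix.scalar (Fin m) (p 0) -
          shearRows (fun j => p j.succ) * Matrix.of fun i j => U (i, j)).det‖ ^ 2) *
            gaussianDensity (eigenChart U p)) =
      ENNReal.ofReal ((Real.pi ^ (m + 1))⁻¹ * Real.exp (-‖p 0‖ ^ 2) *
        (m.factorial * ∑ k ∈ Finset.range (m + 1), (‖p 0‖ ^ 2) ^ k / k.factorial)) *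
        ENNReal.ofReal (affineNormSq (fun j => p j.succ) ^ (m + 1))⁻¹ := by
  set y : Fin m → ℂ := fun j => p j.succ with hy
  have hN := affineNormSq_pos y
  have hdet := det_rowSubstitution y
  have hdet0 : LinearMap.det (rowSubstitution y) ≠ 0 := by rw [hdet]; positivity
  -- The rows of `a` are the minimisers of the quadratic forms in `norm_sq_row_substitution`, with
  -- `t` the matching entry of `l (1, y)`.
  let a : Fin (m + 1) × Fin m → ℂ := fun ij =>
    p 0 * affineVector p ij.1 * (starRingEnd ℂ) (y ij.2) / affineNormSq y
  have hmeas : Measurable fun U : Fin (m + 1) × Fin m → ℂ => gaussianDensity U *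
        (ENNReal.ofReal (‖(Matrix.scalar (Fin m) (p 0) -
          shearRows y * Matrix.of fun i j => U (i, j)).det‖ ^ 2) *
            gaussianDensity (eigenChart U p)) := by
    refine measurable_gaussianDensity.mul ?_
    have := (measurable_det_scalar_sub_shearRows (m := m) Set.univ MeasurableSet.univ 1).comp
      (measurable_prodMk_left (x := p))
    simpa [Function.comp_def] using this
  rw [lintegral_comp_affine volume hdet0 a hmeas, hdet, abs_of_nonneg (by positivity), mul_comm]
  congr 1
  have hentry : ∀ (z : Fin (m + 1) × Fin m → ℂ) i j, (a + rowSubstitution y z) (i, j) =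
      p 0 * affineVector p i * (starRingEnd ℂ) (y j) / affineNormSq y +
        ∑ k, z (i, k) * invSqrtShear y k j := fun z i j => by
    rw [Pi.add_apply, rowSubstitution_apply]
  have hexp : ∀ z : Fin (m + 1) × Fin m → ℂ,
      gaussianDensity (a + rowSubstitution y z) *
        gaussianDensity (eigenChart (a + rowSubstitution y z) p) =
      ENNReal.ofReal ((Real.pi ^ (m + 1))⁻¹ * Real.exp (-‖p 0‖ ^ 2)) * gaussianDensity z := by
    intro z
    -- The row minima add up to `|l|²` because `|(1, y)|²` equals `affineNormSq y`.
    have hrow : ∑ i, ‖eigenChart (a + rowSubstitution y z) p i‖ ^ 2 +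
        ∑ ij, ‖(a + rowSubstitution y z) ij‖ ^ 2 = ‖p 0‖ ^ 2 + ∑ ij, ‖z ij‖ ^ 2 := by
      rw [Fintype.sum_prod_type, Fintype.sum_prod_type, ← Finset.sum_add_distrib]
      have h1 : ∀ i, ‖eigenChart (a + rowSubstitution y z) p i‖ ^ 2 +
          ∑ j, ‖(a + rowSubstitution y z) (i, j)‖ ^ 2 =
          ‖p 0 * affineVector p i‖ ^ 2 / affineNormSq y + ∑ j, ‖z (i, j)‖ ^ 2 := by
        intro i
        have := norm_sq_row_substitution y (fun k => z (i, k)) (p 0 * affineVector p i)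
        simp only [eigenChart, hentry]
        exact this
      simp_rw [h1]
      rw [Finset.sum_add_distrib, ← Finset.sum_div]
      simp_rw [norm_mul, mul_pow]
      rw [← Finset.mul_sum, sum_norm_sq_affineVector, mul_div_assoc, div_self hN.ne', mul_one]
    unfold gaussianDensity
    rw [← ENNReal.ofReal_mul (by positivity), ← ENNReal.ofReal_mul (by positivity)]
    congr 1
    have : Real.exp (-∑ ij, ‖(a + rowSubstitution y z) ij‖ ^ 2) *
        Real.exp (-∑ i, ‖eigenChart (a + rowSubstitution y z) p i‖ ^ 2) =
        Real.exp (-‖p 0‖ ^ 2) * Real.exp (-∑ ij, ‖z ij‖ ^ 2) := by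
      rw [← Real.exp_add, ← Real.exp_add]
      congr 1
      linarith
    rw [Fintype.card_fin]
    linear_combination (Real.pi ^ Fintype.card (Fin (m + 1) × Fin m))⁻¹ * (Real.pi ^ (m + 1))⁻¹ *
      this
  -- The matrix `[-y, I]` annihilates `(1, y)`, so the shift `a` disappears. The identity `det (l -
  -- A B) = det (l - B A)` then moves the inverse square root to the left, where it forms a
  -- coisometry.
  have hdeteq : ∀ z : Fin (m + 1) × Fin m → ℂ,
      (Matrix.scalar (Fin m) (p 0) -
        shearRows y * Matrix.of fun i j => (a + rowSubstitution y z) (i, j)).det =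
      (Matrix.scalar (Fin m) (p 0) -
        (invSqrtShear y * shearRows y) * Matrix.of fun i j => z (i, j)).det := by
    intro z
    have h1 : (Matrix.of fun i j => (a + rowSubstitution y z) (i, j)) =
        Matrix.vecMulVec (affineVector p) (fun j => p 0 * (starRingEnd ℂ) (y j) / affineNormSq y) +
          (Matrix.of fun i j => z (i, j)) * invSqrtShear y := by
      ext i j
      rw [Matrix.of_apply, hentry, Matrix.add_apply, Matrix.vecMulVec_apply, Matrix.mul_apply]
      simp only [Matrix.of_apply]
      ring
    have h2 : (shearRows y).mulVec (affineVector p) = 0 := by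
      ext i
      simp [shearRows, Matrix.mulVec, dotProduct, Fin.sum_univ_succ, affineVector, hy]
    rw [h1, Matrix.mul_add, Matrix.mul_vecMulVec, h2, Matrix.zero_vecMulVec, zero_add,
      ← Matrix.mul_assoc, det_scalar_sub_mul_comm, ← Matrix.mul_assoc]
  have hint : ∀ z : Fin (m + 1) × Fin m → ℂ,
      gaussianDensity (a + rowSubstitution y z) * (ENNReal.ofReal (‖(Matrix.scalar (Fin m) (p 0) -
        shearRows y * Matrix.of fun i j => (a + rowSubstitution y z) (i, j)).det‖ ^ 2) *
          gaussianDensity (eigenChart (a + rowSubstitution y z) p)) =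
      ENNReal.ofReal ((Real.pi ^ (m + 1))⁻¹ * Real.exp (-‖p 0‖ ^ 2)) *
        (gaussianDensity z * ENNReal.ofReal (‖(Matrix.scalar (Fin m) (p 0) -
          (invSqrtShear y * shearRows y) * Matrix.of fun i j => z (i, j)).det‖ ^ 2)) := by
    intro z
    rw [hdeteq, mul_left_comm, hexp]
    ring
  have hmeas2 : Measurable fun z : Fin (m + 1) × Fin m → ℂ =>
      ENNReal.ofReal (‖(Matrix.scalar (Fin m) (p 0) -
          (invSqrtShear y * shearRows y) * Matrix.of fun i j => z (i, j)).det‖ ^ 2) := by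
    refine Continuous.measurable (ENNReal.continuous_ofReal.comp ?_)
    refine (Continuous.norm (Continuous.matrix_det ?_)).pow 2
    refine continuous_const.sub (continuous_const.matrix_mul ?_)
    exact continuous_matrix fun i j => continuous_apply _
  simp_rw [hint]
  rw [lintegral_const_mul' _ _ ENNReal.ofReal_ne_top,
    ← lintegral_piComplexGaussian _ hmeas2,
    lintegral_norm_det_sub_sq _ _ (invSqrtShear_mul_shearRows_coisometry y),
    ← ENNReal.ofReal_mul (by positivity)]

theorem lintegral_exp_neg_mul_norm_sq {t : ℝ} (ht : 0 < t) :
    ∫⁻ z : ℂ, ENNReal.ofReal (Real.exp (-(t * ‖z‖ ^ 2))) = ENNReal.ofReal (Real.pi / t) := by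
  have h := Complex.integral_exp_neg_mul_rpow (p := 2) (b := t) (by norm_num) ht
  have h' : ∫ z : ℂ, Real.exp (-(t * ‖z‖ ^ 2)) = Real.pi / t := by
    norm_num at h
    rw [Real.rpow_neg_one] at h
    simpa [div_eq_mul_inv] using h
  rw [← h', ofReal_integral_eq_lintegral_ofReal]
  · refine Integrable.of_integral_ne_zero ?_
    rw [h']; positivity
  · exact Eventually.of_forall fun z => by positivity

theorem lintegral_pow_mul_exp_neg_mul {a : ℝ} (ha : 0 < a) (m : ℕ) :
    ∫⁻ t in Set.Ioi (0 : ℝ), ENNReal.ofReal (t ^ m * Real.exp (-(a * t))) =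
      ENNReal.ofReal (m.factorial * (a ^ (m + 1))⁻¹) := by
  have h := Real.integral_rpow_mul_exp_neg_mul_Ioi (a := m + 1) (r := a) (by positivity) ha
  have h' : ∫ t in Set.Ioi (0 : ℝ), t ^ m * Real.exp (-(a * t)) =
      m.factorial * (a ^ (m + 1))⁻¹ := by
    rw [Real.Gamma_nat_eq_factorial] at h
    have e : (1 / a) ^ ((m : ℝ) + 1) = (a ^ (m + 1))⁻¹ := by
      rw [one_div, ← Nat.cast_succ, Real.rpow_natCast, inv_pow]
    rw [e] at h
    rw [mul_comm, ← h]
    refine setIntegral_congr_fun measurableSet_Ioi fun t _ => ?_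
    simp [Real.rpow_natCast]
  rw [← h', ofReal_integral_eq_lintegral_ofReal]
  · refine Integrable.of_integral_ne_zero ?_
    rw [h']; positivity
  · exact (ae_restrict_mem measurableSet_Ioi).mono fun t (ht : 0 < t) => by positivity

/-- The volume of the affine chart of projective space. -/
theorem lintegral_affineNormSq_pow_inv (m : ℕ) :
    ∫⁻ y : Fin m → ℂ, ENNReal.ofReal (affineNormSq y ^ (m + 1))⁻¹ =
      ENNReal.ofReal (Real.pi ^ m / m.factorial) := by
  -- A Gamma integral replaces the power by exponentials, which factor over the coordinates of `y`.
  have h1 : ∀ y : Fin m → ℂ, ENNReal.ofReal (affineNormSq y ^ (m + 1))⁻¹ =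
      ∫⁻ t in Set.Ioi (0 : ℝ), ENNReal.ofReal (m.factorial : ℝ)⁻¹ *
        ENNReal.ofReal (t ^ m * Real.exp (-(affineNormSq y * t))) := by
    intro y
    rw [lintegral_const_mul _ (by fun_prop), lintegral_pow_mul_exp_neg_mul (affineNormSq_pos y),
      ← ENNReal.ofReal_mul (by positivity), ← mul_assoc, inv_mul_cancel₀ (by positivity), one_mul]
  have hcont : Continuous fun y : Fin m → ℂ => affineNormSq y := by
    unfold affineNormSq; fun_prop
  simp_rw [h1]
  rw [lintegral_lintegral_swap]
  swap
  · refine Measurable.aemeasurable ?_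
    have := hcont.measurable
    fun_prop
  -- The Gaussian integrals give `(π / t)^m`, which cancels `t^m`. The factors `t ^ 0` and `1 * t`
  -- match the Gamma integral used again at the end.
  have h2 : ∀ t ∈ Set.Ioi (0 : ℝ), ∫⁻ y : Fin m → ℂ, ENNReal.ofReal (m.factorial : ℝ)⁻¹ *
        ENNReal.ofReal (t ^ m * Real.exp (-(affineNormSq y * t))) =
      ENNReal.ofReal (Real.pi ^ m / m.factorial) * ENNReal.ofReal (t ^ 0 * Real.exp (-(1 * t))) := by
    intro t ht
    replace ht : 0 < t := ht
    have h3 : ∀ y : Fin m → ℂ, ENNReal.ofReal (m.factorial : ℝ)⁻¹ *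
        ENNReal.ofReal (t ^ m * Real.exp (-(affineNormSq y * t))) =
        ENNReal.ofReal ((m.factorial : ℝ)⁻¹ * (t ^ m * Real.exp (-t))) *
          ∏ j, ENNReal.ofReal (Real.exp (-(t * ‖y j‖ ^ 2))) := by
      intro y
      rw [← ENNReal.ofReal_prod_of_nonneg fun i _ => by positivity, ← Real.exp_sum,
        ← ENNReal.ofReal_mul (by positivity), ← ENNReal.ofReal_mul (by positivity)]
      have e : -(affineNormSq y * t) = -t + ∑ j, -(t * ‖y j‖ ^ 2) := by
        rw [Finset.sum_neg_distrib, ← Finset.mul_sum, affineNormSq]; ring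
      rw [e, Real.exp_add]
      congr 1
      ring
    simp_rw [h3]
    rw [lintegral_const_mul _ (by fun_prop), volume_pi, lintegral_fintype_prod_eq_prod
      (f := fun _ z => ENNReal.ofReal (Real.exp (-(t * ‖z‖ ^ 2)))) fun _ => by fun_prop]
    simp_rw [lintegral_exp_neg_mul_norm_sq ht]
    rw [Finset.prod_const, Finset.card_univ, Fintype.card_fin, ← ENNReal.ofReal_pow (by positivity),
      ← ENNReal.ofReal_mul (by positivity), ← ENNReal.ofReal_mul (by positivity)]
    congr 1
    rw [div_pow]
    field_simp
  rw [setLIntegral_congr_fun measurableSet_Ioi h2, lintegral_const_mul _ (by fun_prop),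
    lintegral_pow_mul_exp_neg_mul one_pos]
  simp

end EigenvalueDensity

/-! ### Lower bound for the mean eigenvalue count -/

section MeanEigenvalueDensity

variable {m : ℕ}

theorem empiricalEigenvalueMeasure_eq_eigenvalueCount {n : ℕ} (A : Matrix (Fin n) (Fin n) ℂ)
    {V : Set ℂ} (hV : MeasurableSet V) :
    empiricalEigenvalueMeasure A V = (n : ℝ≥0∞)⁻¹ * eigenvalueCount A V := by
  obtain ⟨l, hl⟩ := exists_eigenvalue_enumeration A
  rw [empiricalEigenvalueMeasure_apply hl, eigenvalueCount, hl, Multiset.map_map]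
  congr 1
  exact Finset.sum_congr rfl fun i _ => Measure.dirac_apply' _ hV

theorem measurable_eigenvalueCount {α : Type*} [MeasurableSpace α] {n : ℕ}
    {A : α → Matrix (Fin n) (Fin n) ℂ} (hA : ∀ i j, Measurable fun a => A a i j)
    {V : Set ℂ} (hV : MeasurableSet V) : Measurable fun a => eigenvalueCount (A a) V := by
  rcases Nat.eq_zero_or_pos n with rfl | hn
  · have : (fun a => eigenvalueCount (A a) V) = fun _ => 0 := by
      ext a
      simp [eigenvalueCount]
    rw [this]; exact measurable_const
  · have : (fun a => eigenvalueCount (A a) V) =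
        fun a => (n : ℝ≥0∞) * empiricalEigenvalueMeasure (A a) V := by
      ext a
      rw [empiricalEigenvalueMeasure_eq_eigenvalueCount _ hV, ← mul_assoc,
        ENNReal.mul_inv_cancel (by exact_mod_cast hn.ne') (ENNReal.natCast_ne_top n), one_mul]
    rw [this]
    exact ((Measure.measurable_coe hV).comp
      (measurable_empiricalEigenvalueMeasure hn hA)).const_mul _

theorem measurable_smul_bordered_apply (s : ℝ) (i j : Fin (m + 1)) :
    Measurable fun x : (Fin (m + 1) → ℂ) × (Fin (m + 1) × Fin m → ℂ) =>
      (s • bordered x.1 x.2) i j := by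
  simp only [Matrix.smul_apply, bordered, Matrix.of_apply]
  refine Fin.cases ?_ (fun k => ?_) j
  · simp only [Fin.cons_zero]; fun_prop
  · simp only [Fin.cons_succ]; fun_prop

/-- The density of the mean eigenvalue counting measure of the Ginibre ensemble of size `n`. -/
noncomputable def ginibreDensity (n : ℕ) (z : ℂ) : ℝ≥0∞ :=
  ENNReal.ofReal (Real.pi⁻¹ * (Real.exp (-‖z‖ ^ 2) *
    ∑ k ∈ Finset.range n, (‖z‖ ^ 2) ^ k / k.factorial))

theorem measurable_ginibreDensity (n : ℕ) : Measurable (ginibreDensity n) := by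
  unfold ginibreDensity; fun_prop

theorem lintegral_head_mul_tail {F : ℂ → ℝ≥0∞} {H : (Fin m → ℂ) → ℝ≥0∞} (hF : Measurable F)
    (hH : Measurable H) :
    ∫⁻ p : Fin (m + 1) → ℂ, F (p 0) * H (fun j => p j.succ) = (∫⁻ z, F z) * ∫⁻ y, H y := by
  have h := (volume_preserving_piFinSuccAbove (fun _ : Fin (m + 1) => ℂ) 0).lintegral_comp
    (f := fun x : ℂ × (Fin m → ℂ) => F x.1 * H x.2) (by fun_prop)
  rw [Measure.volume_eq_prod, lintegral_prod_mul hF.aemeasurable hH.aemeasurable] at h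
  rw [← h]
  rfl

theorem lintegral_prod_piComplexGaussian {ι κ : Type*} [Fintype ι] [Fintype κ]
    {K : (ι → ℂ) × (κ → ℂ) → ℝ≥0∞} (hK : Measurable K) :
    ∫⁻ x, K x ∂((piComplexGaussian ι).prod (piComplexGaussian κ)) =
      ∫⁻ u, gaussianDensity u * ∫⁻ c, gaussianDensity c * K (c, u) := by
  rw [lintegral_prod_symm' K hK, lintegral_piComplexGaussian _ hK.lintegral_prod_left']
  refine lintegral_congr fun u => ?_
  rw [lintegral_piComplexGaussian (fun c => K (c, u)) (hK.comp measurable_prodMk_right)]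

/-- The mean number of eigenvalues in a set is at least the integral of the Ginibre density. -/
theorem lintegral_ginibreDensity_le {V : Set ℂ} (hV : MeasurableSet V) {s : ℝ} (hs : s ≠ 0) :
    ∫⁻ z, V.indicator 1 (s • z) * ginibreDensity (m + 1) z ≤
      ∫⁻ x, eigenvalueCount (s • bordered x.1 x.2) V
        ∂((piComplexGaussian (Fin (m + 1))).prod (piComplexGaussian (Fin (m + 1) × Fin m))) := by
  have hcount := measurable_eigenvalueCount (measurable_smul_bordered_apply (m := m) s) hV
  have hind : Measurable fun z : ℂ => V.indicator (1 : ℂ → ℝ≥0∞) (s • z) :=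
    (measurable_one.indicator hV).comp (by fun_prop)
  let D : (Fin (m + 1) → ℂ) → (Fin (m + 1) × Fin m → ℂ) → ℝ≥0∞ := fun p U =>
    ENNReal.ofReal (‖(Matrix.scalar (Fin m) (p 0) -
      shearRows (fun j => p j.succ) * Matrix.of fun i j => U (i, j)).det‖ ^ 2)
  have hDm : Measurable fun x : (Fin (m + 1) → ℂ) × (Fin (m + 1) × Fin m → ℂ) =>
      D x.1 x.2 * (V.indicator 1 (s • x.1 0) * gaussianDensity (eigenChart x.2 x.1)) :=
    measurable_det_scalar_sub_shearRows V hV s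
  calc ∫⁻ z, V.indicator 1 (s • z) * ginibreDensity (m + 1) z
      = ∫⁻ p : Fin (m + 1) → ℂ, (V.indicator 1 (s • p 0) *
          ENNReal.ofReal ((Real.pi ^ (m + 1))⁻¹ * Real.exp (-‖p 0‖ ^ 2) *
          (m.factorial * ∑ k ∈ Finset.range (m + 1), (‖p 0‖ ^ 2) ^ k / k.factorial))) *
          ENNReal.ofReal (affineNormSq (fun j => p j.succ) ^ (m + 1))⁻¹ := by
        -- The integral over `y` contributes `π^m / m!`, which reduces the prefactor `m! / π^(m+1)`
        -- to `π⁻¹`.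
        rw [lintegral_head_mul_tail
          (F := fun z => V.indicator 1 (s • z) *
            ENNReal.ofReal ((Real.pi ^ (m + 1))⁻¹ * Real.exp (-‖z‖ ^ 2) *
            (m.factorial * ∑ k ∈ Finset.range (m + 1), (‖z‖ ^ 2) ^ k / k.factorial)))
          (H := fun y => ENNReal.ofReal (affineNormSq y ^ (m + 1))⁻¹)
          (hind.mul (by fun_prop)) (by unfold affineNormSq; fun_prop),
          lintegral_affineNormSq_pow_inv, ← lintegral_mul_const' _ _ ENNReal.ofReal_ne_top]
        refine lintegral_congr fun z => ?_
        rw [mul_assoc, ← ENNReal.ofReal_mul (by positivity), ginibreDensity]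
        congr 2
        have := Real.pi_ne_zero
        field_simp
        ring
    _ = ∫⁻ p : Fin (m + 1) → ℂ, ∫⁻ U : Fin (m + 1) × Fin m → ℂ, gaussianDensity U *
          (D p U * (V.indicator 1 (s • p 0) * gaussianDensity (eigenChart U p))) := by
        refine lintegral_congr fun p => ?_
        rw [mul_assoc, ← lintegral_det_mul_gaussianDensity, ← lintegral_const_mul']
        · refine lintegral_congr fun U => ?_
          ring
        · exact ((Set.indicator_le_self V (1 : ℂ → ℝ≥0∞) _).trans_lt ENNReal.one_lt_top).ne
    _ = ∫⁻ U : Fin (m + 1) × Fin m → ℂ, ∫⁻ p : Fin (m + 1) → ℂ, gaussianDensity U *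
          (D p U * (V.indicator 1 (s • p 0) * gaussianDensity (eigenChart U p))) :=
        lintegral_lintegral_swap
          ((measurable_gaussianDensity.comp measurable_snd).mul hDm).aemeasurable
    _ = ∫⁻ U : Fin (m + 1) × Fin m → ℂ, gaussianDensity U * ∫⁻ p : Fin (m + 1) → ℂ,
          (D p U * (V.indicator 1 (s • p 0) * gaussianDensity (eigenChart U p))) :=
        lintegral_congr fun U => lintegral_const_mul' _ _ ENNReal.ofReal_ne_top
    _ ≤ ∫⁻ U : Fin (m + 1) × Fin m → ℂ, gaussianDensity U * ∫⁻ c : Fin (m + 1) → ℂ,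
          eigenvalueCount (s • bordered c U) V * gaussianDensity c := by
        exact lintegral_mono fun U =>
          mul_le_mul_right (lintegral_eigenChart_le U V hs gaussianDensity) _
    _ = _ := by
        rw [lintegral_prod_piComplexGaussian hcount]
        simp_rw [mul_comm (eigenvalueCount _ V)]

theorem lintegral_comp_smul_complex {F : ℂ → ℝ≥0∞} (hF : Measurable F) {r : ℝ} (hr : 0 < r) :
    ∫⁻ z, F z = ENNReal.ofReal (r ^ 2) * ∫⁻ z, F (r • z) := by
  have hdet : LinearMap.det (r • (LinearMap.id : ℂ →ₗ[ℝ] ℂ)) = r ^ 2 := by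
    rw [LinearMap.det_smul, Complex.finrank_real_complex, LinearMap.det_id, mul_one]
  have h := lintegral_comp_affine (volume : Measure ℂ) (T := r • (LinearMap.id : ℂ →ₗ[ℝ] ℂ))
    (by rw [hdet]; positivity) 0 hF
  rw [hdet, abs_of_pos (by positivity)] at h
  simpa using h

end MeanEigenvalueDensity

/-! ### Transfer to the random table -/

section Ginibre

/-- The first column and the remaining columns of the `(m + 1) × (m + 1)` corner of a table. -/
def cornerColumns {Ω : Type*} (G : ℕ → ℕ → Ω → ℂ) (m : ℕ) (ω : Ω) :
    (Fin (m + 1) → ℂ) × (Fin (m + 1) × Fin m → ℂ) :=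
  (fun i => G i 0 ω, fun ij => G ij.1 (ij.2 + 1) ω)

theorem scaledCorner_eq_bordered {Ω : Type*} (G : ℕ → ℕ → Ω → ℂ) (m : ℕ) (ω : Ω) :
    scaledCorner G (m + 1) ω =
      (Real.sqrt (m + 1 : ℕ))⁻¹ • bordered (cornerColumns G m ω).1 (cornerColumns G m ω).2 := by
  rw [scaledCorner]
  congr 1
  ext i j
  refine Fin.cases ?_ (fun k => ?_) j <;> simp [bordered, cornerColumns]

variable {Ω : Type*} [MeasurableSpace Ω] {P : Measure Ω} {G : ℕ → ℕ → Ω → ℂ}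

theorem IsComplexGinibre.aemeasurable_cornerColumns (hG : IsComplexGinibre P G) (m : ℕ) :
    AEMeasurable (cornerColumns G m) P :=
  (aemeasurable_pi_lambda _ fun _ => (hG.hasLaw _ _).aemeasurable).prodMk
    (aemeasurable_pi_lambda _ fun _ => (hG.hasLaw _ _).aemeasurable)

theorem IsComplexGinibre.aemeasurable_empiricalEigenvalueMeasure (hG : IsComplexGinibre P G)
    {n : ℕ} (hn : 1 ≤ n) :
    AEMeasurable (fun ω => empiricalEigenvalueMeasure (scaledCorner G n ω)) P := by
  obtain ⟨m, rfl⟩ := Nat.exists_eq_add_of_le' hn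
  simp_rw [scaledCorner_eq_bordered]
  exact (measurable_empiricalEigenvalueMeasure hn
    (measurable_smul_bordered_apply _)).comp_aemeasurable (hG.aemeasurable_cornerColumns m)

variable [IsProbabilityMeasure P]

theorem IsComplexGinibre.map_cornerColumns (hG : IsComplexGinibre P G) (m : ℕ) :
    P.map (cornerColumns G m) =
      (piComplexGaussian (Fin (m + 1))).prod (piComplexGaussian (Fin (m + 1) × Fin m)) := by
  let e : Fin (m + 1) ⊕ Fin (m + 1) × Fin m → ℕ × ℕ :=
    Sum.elim (fun i => (i, 0)) fun ij => (ij.1, ij.2 + 1)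
  have he : Function.Injective e := by
    rintro (i | ⟨i, j⟩) (i' | ⟨i', j'⟩) h <;> simp [e] at h ⊢
    · exact Fin.ext h
    · exact ⟨Fin.ext h.1, Fin.ext h.2⟩
  have hind := hG.indep.precomp he
  have hm : ∀ k, AEMeasurable (fun ω => G (e k).1 (e k).2 ω) P := fun k =>
    (hG.hasLaw _ _).aemeasurable
  have hlaw := (iIndepFun_iff_map_fun_eq_pi_map hm).1 hind
  have hlaw' : P.map (fun ω k => G (e k).1 (e k).2 ω) =
      Measure.pi fun _ : Fin (m + 1) ⊕ Fin (m + 1) × Fin m => complexGaussian := by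
    rw [hlaw]
    congr 1 with k : 1
    exact (hG.hasLaw _ _).map_eq
  have hsplit := measurePreserving_sumPiEquivProdPi
    fun _ : Fin (m + 1) ⊕ Fin (m + 1) × Fin m => complexGaussian
  have hcomp : cornerColumns G m = MeasurableEquiv.sumPiEquivProdPi
      (fun _ : Fin (m + 1) ⊕ Fin (m + 1) × Fin m => ℂ) ∘ fun ω k => G (e k).1 (e k).2 ω := rfl
  rw [hcomp, ← AEMeasurable.map_map_of_aemeasurable hsplit.measurable.aemeasurable
    (aemeasurable_pi_lambda _ hm), hlaw', hsplit.map_eq]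
  rfl

theorem IsComplexGinibre.isProbabilityMeasure_meanMeasure (hG : IsComplexGinibre P G)
    {n : ℕ} (hn : 1 ≤ n) : IsProbabilityMeasure
      (meanMeasure P fun ω => empiricalEigenvalueMeasure (scaledCorner G n ω)) := by
  refine ⟨?_⟩
  have hp := fun ω => isProbabilityMeasure_empiricalEigenvalueMeasure hn (scaledCorner G n ω)
  rw [meanMeasure, Measure.bind_apply MeasurableSet.univ
    (hG.aemeasurable_empiricalEigenvalueMeasure hn)]
  simp

/-- The mean empirical eigenvalue measure dominates the rescaled Ginibre density. -/
theorem IsComplexGinibre.lintegral_ginibreDensity_le_meanMeasure (hG : IsComplexGinibre P G)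
    (m : ℕ) {V : Set ℂ} (hV : MeasurableSet V) :
    ∫⁻ z in V, ginibreDensity (m + 1) (Real.sqrt (m + 1 : ℕ) • z) ≤
      meanMeasure P (fun ω => empiricalEigenvalueMeasure (scaledCorner G (m + 1) ω)) V := by
  set r : ℝ := Real.sqrt (m + 1 : ℕ) with hr
  have hr0 : 0 < r := Real.sqrt_pos.2 (by positivity)
  have hcount := measurable_eigenvalueCount (measurable_smul_bordered_apply (m := m) r⁻¹) hV
  have hmean : meanMeasure P (fun ω => empiricalEigenvalueMeasure (scaledCorner G (m + 1) ω)) V =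
      ((m + 1 : ℕ) : ℝ≥0∞)⁻¹ * ∫⁻ x, eigenvalueCount (r⁻¹ • bordered x.1 x.2) V
        ∂((piComplexGaussian (Fin (m + 1))).prod (piComplexGaussian (Fin (m + 1) × Fin m))) := by
    rw [meanMeasure, Measure.bind_apply hV
      (hG.aemeasurable_empiricalEigenvalueMeasure (Nat.le_add_left 1 m))]
    simp_rw [empiricalEigenvalueMeasure_eq_eigenvalueCount _ hV, scaledCorner_eq_bordered]
    rw [lintegral_const_mul' _ _ (by simp), ← hG.map_cornerColumns m,
      lintegral_map' hcount.aemeasurable (hG.aemeasurable_cornerColumns m)]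
  have hF : Measurable fun z : ℂ => V.indicator 1 (r⁻¹ • z) * ginibreDensity (m + 1) z :=
    ((measurable_one.indicator hV).comp (by fun_prop)).mul (measurable_ginibreDensity _)
  have hrsq : ENNReal.ofReal (r ^ 2) = ((m + 1 : ℕ) : ℝ≥0∞) := by
    rw [hr, Real.sq_sqrt (by positivity), ENNReal.ofReal_natCast]
  rw [hmean]
  refine le_trans (le_of_eq ?_)
    (mul_le_mul_right (lintegral_ginibreDensity_le (m := m) hV (inv_ne_zero hr0.ne')) _)
  -- In real dimension two, rescaling by `√n` produces the factor `n`, which cancels the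
  -- normalisation of the empirical measure.
  rw [lintegral_comp_smul_complex hF hr0, hrsq, ← mul_assoc,
    ENNReal.inv_mul_cancel (by simp) (ENNReal.natCast_ne_top _), one_mul, ← lintegral_indicator hV]
  refine lintegral_congr fun z => ?_
  rw [inv_smul_smul₀ hr0.ne']
  by_cases hz : z ∈ V <;> simp [hz]

end Ginibre

/-! ### Limit of the density and weak convergence -/

section Limit

/-- In the tail `k ≥ n` of the exponential series of `n x`, `x^k ≤ x^n`, so the tail is at most `x^n
exp n`. -/
theorem one_sub_le_exp_neg_mul_sum {x : ℝ} (hx0 : 0 ≤ x) (hx1 : x ≤ 1) (n : ℕ) :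
    1 - (x * Real.exp (1 - x)) ^ n ≤
      Real.exp (-(n * x)) * ∑ k ∈ Finset.range n, (n * x) ^ k / k.factorial := by
  have hs : ∀ a : ℝ, HasSum (fun k : ℕ => a ^ k / k.factorial) (Real.exp a) := fun a => by
    rw [Real.exp_eq_exp_ℝ]; exact NormedSpace.expSeries_div_hasSum_exp a
  have h1 : Real.exp (n * x) ≤ ∑ k ∈ Finset.range n, (n * x) ^ k / k.factorial +
      x ^ n * Real.exp n := by
    have h2 := (hs (n * x)).summable.sum_add_tsum_nat_add n
    rw [(hs (n * x)).tsum_eq] at h2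
    rw [← h2]
    gcongr
    have h3 : ∑' k : ℕ, x ^ n * ((n : ℝ) ^ (k + n) / (k + n).factorial) ≤ x ^ n * Real.exp n := by
      rw [tsum_mul_left]
      gcongr
      rw [← (hs n).tsum_eq, ← (hs n).summable.sum_add_tsum_nat_add n]
      exact le_add_of_nonneg_left (Finset.sum_nonneg fun k _ => by positivity)
    refine le_trans (Summable.tsum_le_tsum (fun k => ?_) ?_ ?_) h3
    · rw [mul_pow, mul_comm ((n : ℝ) ^ _), mul_div_assoc]
      gcongr ?_ * _
      exact pow_le_pow_of_le_one hx0 hx1 (Nat.le_add_left n k)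
    · exact (summable_nat_add_iff n).2 (hs (n * x)).summable
    · exact ((summable_nat_add_iff n).2 (hs n).summable).mul_left _
  have h4 : Real.exp (-(n * x)) * Real.exp (n * x) = 1 := by rw [← Real.exp_add]; simp
  have h5 : (x * Real.exp (1 - x)) ^ n = Real.exp (-(n * x)) * (x ^ n * Real.exp n) := by
    rw [mul_pow, ← Real.exp_nat_mul, mul_left_comm, ← Real.exp_add]
    congr 2
    ring
  have h6 := mul_le_mul_of_nonneg_left h1 (Real.exp_pos (-(n * x))).le
  rw [h4, mul_add, ← h5] at h6
  linarith

theorem tendsto_ginibreDensity {z : ℂ} (hz : ‖z‖ < 1) :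
    Tendsto (fun m : ℕ => ginibreDensity (m + 1) (Real.sqrt (m + 1 : ℕ) • z)) atTop
      (𝓝 (ENNReal.ofReal Real.pi⁻¹)) := by
  have hx1 : ‖z‖ ^ 2 < 1 := by
    rw [sq_lt_one_iff₀ (norm_nonneg z)]; exact hz
  set x := ‖z‖ ^ 2 with hx
  have hx0 : 0 ≤ x := by positivity
  have hlim : Tendsto (fun n : ℕ => Real.exp (-(n * x)) *
      ∑ k ∈ Finset.range n, (n * x) ^ k / k.factorial) atTop (𝓝 1) := by
    -- This is the strict inequality `1 + u < exp u` at `u = x - 1`.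
    have hq : x * Real.exp (1 - x) < 1 := by
      have h := Real.add_one_lt_exp (x := x - 1) (by linarith)
      calc x * Real.exp (1 - x) < Real.exp (x - 1) * Real.exp (1 - x) := by
            gcongr; linarith
        _ = 1 := by rw [← Real.exp_add]; simp
    refine tendsto_of_tendsto_of_tendsto_of_le_of_le
      (g := fun n : ℕ => 1 - (x * Real.exp (1 - x)) ^ n) ?_ tendsto_const_nhds
      (fun n => one_sub_le_exp_neg_mul_sum hx0 hx1.le n) fun n => ?_
    · simpa using (tendsto_pow_atTop_nhds_zero_of_lt_one (by positivity) hq).const_sub 1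
    · calc _ ≤ Real.exp (-(n * x)) * Real.exp (n * x) := by
            gcongr
            exact Real.sum_le_exp_of_nonneg (by positivity) n
        _ = 1 := by rw [← Real.exp_add]; simp
  have h1 := ((hlim.comp (tendsto_add_atTop_nat 1)).const_mul Real.pi⁻¹)
  rw [mul_one] at h1
  refine ((ENNReal.continuous_ofReal.tendsto _).comp h1).congr fun m => ?_
  have hn : ‖Real.sqrt (m + 1 : ℕ) • z‖ ^ 2 = ((m + 1 : ℕ) : ℝ) * x := by
    rw [norm_smul, mul_pow, Real.norm_eq_abs, sq_abs, Real.sq_sqrt (by positivity)]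
  simp only [Function.comp_apply, ginibreDensity, hn]

theorem isProbabilityMeasure_circularLaw : IsProbabilityMeasure circularLaw := by
  refine ⟨?_⟩
  have hset : {z : ℂ | ‖z‖ ≤ 1} = Metric.closedBall 0 1 := by ext z; simp
  rw [circularLaw, withDensity_apply _ MeasurableSet.univ, Measure.restrict_univ, hset,
    lintegral_indicator Metric.isClosed_closedBall.measurableSet, setLIntegral_const,
    Complex.volume_closedBall]
  rw [ENNReal.ofReal_inv_of_pos Real.pi_pos]
  simp only [ENNReal.ofReal_one, one_pow, one_mul]
  rw [show (NNReal.pi : ℝ≥0∞) = ENNReal.ofReal Real.pi by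
    rw [← NNReal.coe_real_pi, ENNReal.ofReal_coe_nnreal]]
  exact ENNReal.inv_mul_cancel (by simp [Real.pi_pos]) ENNReal.ofReal_ne_top

/-- Fatou's lemma applied to the rescaled densities. The unit circle, where the pointwise limit is
not computed, is Lebesgue null, and outside the disc the trivial bound `0` suffices. -/
theorem circularLaw_le_liminf {Ω : Type*} [MeasurableSpace Ω] {P : Measure Ω}
    [IsProbabilityMeasure P] {G : ℕ → ℕ → Ω → ℂ} (hG : IsComplexGinibre P G) {V : Set ℂ}
    (hV : MeasurableSet V) :
    circularLaw V ≤ liminf (fun m : ℕ => meanMeasure P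
      (fun ω => empiricalEigenvalueMeasure (scaledCorner G (m + 1) ω)) V) atTop := by
  have hsphere : ∀ᵐ z : ℂ, ‖z‖ ≠ 1 := by
    have h := Measure.addHaar_sphere (volume : Measure ℂ) 0 1
    rw [ae_iff]
    convert h using 2
    ext z
    simp
  calc circularLaw V
      = ∫⁻ z in V, ({z : ℂ | ‖z‖ ≤ 1}.indicator fun _ => ENNReal.ofReal Real.pi⁻¹) z := by
        rw [circularLaw, withDensity_apply _ hV]
    _ ≤ ∫⁻ z in V, liminf (fun m : ℕ =>
          ginibreDensity (m + 1) (Real.sqrt (m + 1 : ℕ) • z)) atTop := by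
        refine lintegral_mono_ae ((ae_restrict_of_ae hsphere).mono fun z hz => ?_)
        by_cases h : ‖z‖ ≤ 1
        · rw [Set.indicator_of_mem (show z ∈ {z : ℂ | ‖z‖ ≤ 1} from h),
            (tendsto_ginibreDensity (lt_of_le_of_ne h hz)).liminf_eq]
        · rw [Set.indicator_of_notMem (show z ∉ {z : ℂ | ‖z‖ ≤ 1} from h)]
          exact zero_le
    _ ≤ liminf (fun m : ℕ => ∫⁻ z in V,
          ginibreDensity (m + 1) (Real.sqrt (m + 1 : ℕ) • z)) atTop :=
        lintegral_liminf_le fun m => (measurable_ginibreDensity _).comp (by fun_prop)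
    _ ≤ _ := liminf_le_liminf
        (Eventually.of_forall fun m => hG.lintegral_ginibreDensity_le_meanMeasure m hV)

end Limit

theorem mainTheorem3 {Ω : Type*} [MeasurableSpace Ω] (P : Measure Ω) [IsProbabilityMeasure P]
    (G : ℕ → ℕ → Ω → ℂ) (hG : IsComplexGinibre P G) :
    (∀ n : ℕ, 1 ≤ n →
      AEMeasurable (fun ω => empiricalEigenvalueMeasure (scaledCorner G n ω)) P ∧
      IsProbabilityMeasure
        (meanMeasure P fun ω => empiricalEigenvalueMeasure (scaledCorner G n ω))) ∧
    IsProbabilityMeasure circularLaw ∧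
    ∀ f : ℂ →ᵇ ℝ,
      Tendsto
        (fun n : ℕ => ∫ z, f z
          ∂(meanMeasure P fun ω => empiricalEigenvalueMeasure (scaledCorner G n ω)))
        atTop (𝓝 (∫ z, f z ∂circularLaw)) := by
  refine ⟨fun n hn => ⟨hG.aemeasurable_empiricalEigenvalueMeasure hn,
    hG.isProbabilityMeasure_meanMeasure hn⟩, isProbabilityMeasure_circularLaw, fun f => ?_⟩
  -- The index is shifted because the empirical measure of the empty matrix is zero.
  let ν : ℕ → ProbabilityMeasure ℂ := fun m =>
    ⟨meanMeasure P fun ω => empiricalEigenvalueMeasure (scaledCorner G (m + 1) ω),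
      hG.isProbabilityMeasure_meanMeasure (Nat.le_add_left 1 m)⟩
  let C : ProbabilityMeasure ℂ := ⟨circularLaw, isProbabilityMeasure_circularLaw⟩
  -- Here equality of total masses upgrades the one-sided bound on open sets to weak convergence.
  have hν : Tendsto ν atTop (𝓝 C) := tendsto_of_forall_isOpen_le_liminf' fun V hV =>
    circularLaw_le_liminf hG hV.measurableSet
  have h := ProbabilityMeasure.tendsto_iff_forall_integral_tendsto.1 hν f
  exact (tendsto_add_atTop_iff_nat 1).1 h
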